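/- **Setting.** Let $d\in\{1,2,\dots\}$ and $H\in(0,1)$. For $\beta<0$, $\rho\in[1,\infty]$ and bounded measurable $g\colon\mathbb R^d\to\mathbb R^d$ put $\|g\|_{\mathcal B^\beta_\rho}:=\sup_{a\in(0,1]}a^{-\beta/2}\|p_a*g\|_{L_\rho(\mathbb R^d)}$, where $p_a$ is the density of $N(0,a\,\mathrm{Id})$ on $\mathbb R^d$. Let $(\mathcal F_t)_{t\in[0,1]}$ be a filtration on a probability space $(\Omega,\mathcal F,\mathbb P)$, and write $\mathbb E^s=\mathbb E[\,\cdot\,|\mathcal F_s]$. Let $Y\colon[0,1]\times\Omega\to\mathbb R^d$ be a (jointly) measurable adapted process with $\mathbb E|Y_t|<\infty$ for all $t$, and put $Y_{s,t}:=Y_t-\mathbb E^sY_t$. Let $\kappa\ge0$ and $K(\beta,\rho)\ge0$ ($\beta<0$, $\rho\in[1,\infty]$) be constants. Assume: 1. for all $0\le s\le t\le1$, $Y_{s,t}$ is independent of $\mathcal F_s$; 2. for all $0\le s<u\le t\le1$, $\mathbb E^uY_{s,t}$ has a density $p_{s,u,t}$ with respect to the Lebesgue measure and $$\|p_{s,u,t}\|_{L_\infty(\mathbb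 R^d)}\le\kappa\bigl((u-s)^{-Hd}+((t-s)^{2H}-(t-u)^{2H})^{-d/2}\bigr);$$ 3. for all $\beta<0$, $\rho\in[1,\infty]$, bounded measurable $g\colon\mathbb R^d\to\mathbb R^d$ and $0\le s<t\le1$, $$\|\mathbb E\,g(Y_{s,t}+\cdot)\|_{L_\rho(\mathbb R^d)}\le K(\beta,\rho)\,\|g\|_{\mathcal B^\beta_\rho}\,(t-s)^{\beta H}.$$ **Statement.** Let $m\in[2,\infty)$, and let $p,q\in[1,\infty)$ satisfy $\frac{1-H}{q}+\frac{Hd}{p}<1-H$. There exist $C>0$ and $\gamma\in(0,1)$, depending only on $H,d,p,q,m,\kappa,K$, such that the following holds for every $(\Omega,\mathcal F,\mathbb P)$, $(\mathcal F_t)$ and $Y$ as above, every $x\in\mathbb R^d$, every bounded measurable $f\colon[0,1]\times\mathbb R^d\to\mathbb R^d$ with $f\in L_q([0,1],L_p(\mathbb R^d))$, and every process $\psi$ adapted to $(\mathcal F_t)$ such that almost surely $$\psi_t=\int_0^tf_r(x+\psi_r+Y_r)\,dr\quad\text{for all }t\in[0,1].$$ For all $0\le s\le t\le1$, $$\bigl\|[\psi]_{1\text{-var};[s,t]}\bigr\|_{L_m(\Omega)}\le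 C\bigl(\|f\|_{L_q([s,t],L_p(\mathbb R^d))}+\|f\|^q_{L_q([s,t],L_p(\mathbb R^d))}\bigr)(t-s)^{1-H-\frac{Hd}{p}-\frac{1-H}{q}},$$ and for all $r>0$, $$\mathbb P\bigl(\|\psi\|_{\mathcal C^\gamma([0,1])}\ge r\bigr)\le C\bigl(1+\|f\|^q_{L_q([0,1],L_p(\mathbb R^d))}\bigr)^m r^{-m}.$$ Here $[\psi]_{1\text{-var};[s,t]}$ is the supremum over partitions $s=t_0\le\dots\le t_n=t$ of $\sum_i|\psi_{t_{i+1}}-\psi_{t_i}|$, $\|f\|_{L_q([s,t],L_p(\mathbb R^d))}=\bigl(\int_s^t\|f_r\|^q_{L_p(\mathbb R^d)}dr\bigr)^{1/q}$, and $\|g\|_{\mathcal C^\gamma([0,1])}=\sup_{t\in[0,1]}|g_t|+\sup_{0\le s<t\le1}\frac{|g_t-g_s|}{(t-s)^\gamma}$. -/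

import Mathlib

open MeasureTheory ProbabilityTheory
open scoped NNReal ENNReal

noncomputable section

namespace SingularDrift

/-- Euclidean space `ℝ^d`. -/
abbrev E (d : ℕ) : Type := EuclideanSpace ℝ (Fin d)

/-- The centred Gaussian density on `ℝ^d` with covariance `a • Id`. -/
def heatKernel (d : ℕ) (a : ℝ) (x : E d) : ℝ :=
  (2 * Real.pi * a) ^ (-(d : ℝ) / 2) * Real.exp (-‖x‖ ^ 2 / (2 * a))

/-- The norm of the Besov space `B^β_{ρ,∞}(ℝ^d)` of negative regularity `β < 0`, in its heat
kernel form `sup_{a ∈ (0,1]} a^{-β/2} ‖p_a * g‖_{L_ρ}`. -/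
def besovNorm {d : ℕ} (β : ℝ) (ρ : ℝ≥0∞) (g : E d → E d) : ℝ≥0∞ :=
  ⨆ a ∈ Set.Ioc (0 : ℝ) 1, ENNReal.ofReal (a ^ (-β / 2)) *
    eLpNorm (fun x : E d => ∫ y : E d, heatKernel d a (x - y) • g y) ρ volume

/-- `Y_{s,t} = Y_t - 𝔼[Y_t | ℱ_s]`. -/
def innovation {d : ℕ} {Ω : Type*} [mΩ : MeasurableSpace Ω] (P : Measure Ω)
    (ℱ : Filtration ℝ mΩ) (Y : ℝ → Ω → E d) (s t : ℝ) : Ω → E d :=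
  fun ω => Y t ω - (P[Y t | ℱ s]) ω

/-- The assumption on the noise. Times range over `[0,1]`; only `ℱ t` and `Y t` with `t ∈ [0,1]`
enter. The constant `κ` multiplies the density bound, and `K β ρ` is the constant of the smoothing
bound. The degenerate times (`u = s` in `density`, `t = s` in `smoothing`), at which the
right-hand sides are infinite, are left out. -/
structure NoiseAssumption {d : ℕ} {Ω : Type*} [mΩ : MeasurableSpace Ω] (P : Measure Ω)
    (ℱ : Filtration ℝ mΩ) (H : ℝ) (κ : ℝ≥0) (K : ℝ → ℝ≥0∞ → ℝ≥0)
    (Y : ℝ → Ω → E d) : Prop where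
  indep : ∀ s t : ℝ, 0 ≤ s → s ≤ t → t ≤ 1 →
    Indep (MeasurableSpace.comap (innovation P ℱ Y s t) inferInstance) (ℱ s) P
  density : ∀ s u t : ℝ, 0 ≤ s → s < u → u ≤ t → t ≤ 1 →
    HasPDF (P[innovation P ℱ Y s t | ℱ u]) P volume ∧
    essSup (pdf (P[innovation P ℱ Y s t | ℱ u]) P volume) volume ≤
      κ * ENNReal.ofReal ((u - s) ^ (-(H * d)) +
        ((t - s) ^ (2 * H) - (t - u) ^ (2 * H)) ^ (-(d : ℝ) / 2))
  smoothing : ∀ (β : ℝ) (ρ : ℝ≥0∞), β < 0 → 1 ≤ ρ →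
    ∀ g : E d → E d, Measurable g → (∃ M : ℝ, ∀ x, ‖g x‖ ≤ M) →
    ∀ s t : ℝ, 0 ≤ s → s < t → t ≤ 1 →
    eLpNorm (fun x : E d => ∫ ω, g (innovation P ℱ Y s t ω + x) ∂P) ρ volume ≤
      K β ρ * besovNorm β ρ g * ENNReal.ofReal ((t - s) ^ (β * H))

/-- The norm of `L_q([s,t], L_p(ℝ^d))`. -/
def mixedNorm {d : ℕ} (p q : ℝ) (s t : ℝ) (f : ℝ → E d → E d) : ℝ≥0∞ :=
  (∫⁻ r in Set.Icc s t, (eLpNorm (f r) (ENNReal.ofReal p) volume) ^ q) ^ (1 / q)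

/-- `ψ` solves `ψ_t = ∫_0^t f_r(x + ψ_r + Y_r) dr` for all `t ∈ [0,1]`, almost surely; the integral
is a Lebesgue integral. -/
def IsSolution {d : ℕ} {Ω : Type*} [MeasurableSpace Ω] (P : Measure Ω)
    (x : E d) (f : ℝ → E d → E d) (Y ψ : ℝ → Ω → E d) : Prop :=
  ∀ᵐ ω ∂P,
    IntegrableOn (fun r => f r (x + ψ r ω + Y r ω)) (Set.Icc 0 1) volume ∧
    ∀ t ∈ Set.Icc (0 : ℝ) 1, ψ t ω = ∫ r in (0 : ℝ)..t, f r (x + ψ r ω + Y r ω)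

/-- The norm of the Hölder space `C^γ([0,1], ℝ^d)` (infinite off the space). -/
def holderNorm {d : ℕ} (γ : ℝ) (g : ℝ → E d) : ℝ≥0∞ :=
  (⨆ t ∈ Set.Icc (0 : ℝ) 1, ‖g t‖ₑ) +
  ⨆ s ∈ Set.Icc (0 : ℝ) 1, ⨆ t ∈ Set.Icc (0 : ℝ) 1, ⨆ _ : s < t,
    ‖g t - g s‖ₑ / ENNReal.ofReal ((t - s) ^ γ)

end SingularDrift

end

/-! Write `A_{s,t}` for the integral over `(s,t]` of `|f_r(x + ψ_r + Y_r)|`. It dominates the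
variation of `ψ`, so everything reduces to moments of `A`. Since the integrand is nonnegative, only
upper bounds are needed, and the stochastic sewing is carried out with Lebesgue integrals over sets
`B ∈ ℱ_s` instead of conditional expectations.

Freeze `ψ` at the left endpoints of a dyadic partition. Given `ℱ_u`, the noise `Y_r` is a known
shift plus an independent innovation, so the smoothing assumption bounds the frozen integrand by its
`L_p` norm times `(r-u)^{-Hd/p}`. Moving the freezing point from `a` to `u` costs `|ψ_u - ψ_a|^θ
(r-u)^{-c}` with `c = (d/p + θ)H` (`NoiseAssumption.setLIntegral_comp_add_le_add`). The displacement
is at most `A_{a,b}`, so the error on `[a,b]` involves the `L_q` mass of `f` to the power `1/q` and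
`𝔼[A_{a,b}; B]` to the power `θ`. Both masses are additive in the interval; Hölder over the `2^n`
intervals of level `n` leaves `2^{-n(θ-c)}` (`dyadicSum_succ_le`), summable when `c < θ`. Fatou
removes the freezing, and an approximation argument removes continuity of `f` (`sewing_le`).

The result bounds `y = 𝔼[A_{s,t}; B]` by `a P(B) + b P(B)^{1-θ} y^θ`. As `θ < 1` and `y` is finite,
the power of `y` is absorbed (`le_of_le_add_rpow`), giving `y ≤ Γ P(B)`: a bound on the conditional
first moment. The power `1/(1-θ) ≤ q` produced by absorption accounts for the term `‖f‖^q`.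
Khasminskii's lemma (`setLIntegral_accum_pow_le`) upgrades this to `n! Γ^n` for the `n`-th moment,
and a Kolmogorov-type sum over dyadic intervals (`lintegral_dyadicSup_le`) gives the Hölder bound.

The standing condition on `p, q, H` says exactly that some `θ` satisfies both `c < θ` and `θ < 1 -
1/q`. -/

noncomputable section

namespace SingularDrift

/-! ### Heat kernel estimates. -/

section HeatKernel

variable {d : ℕ} {a : ℝ}

lemma heatKernel_nonneg (ha : 0 < a) (x : E d) : 0 ≤ heatKernel d a x := by
  unfold heatKernel; positivity

lemma continuous_heatKernel (a : ℝ) : Continuous (heatKernel d a) := by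
  unfold heatKernel; fun_prop

lemma heatKernel_le (ha : 0 < a) (x : E d) :
    heatKernel d a x ≤ (2 * Real.pi * a) ^ (-(d : ℝ) / 2) := by
  unfold heatKernel
  refine mul_le_of_le_one_right (by positivity) (Real.exp_le_one_iff.2 ?_)
  exact div_nonpos_of_nonpos_of_nonneg (by simp) (by positivity)

lemma integral_heatKernel (ha : 0 < a) : ∫ x : E d, heatKernel d a x = 1 := by
  have h := GaussianFourier.integral_rexp_neg_mul_sq_norm (V := E d) (b := 1 / (2 * a))
    (by positivity)
  unfold heatKernel
  rw [integral_const_mul]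
  have : (fun x : E d => Real.exp (-‖x‖ ^ 2 / (2 * a)))
      = fun x => Real.exp (-(1 / (2 * a)) * ‖x‖ ^ 2) := by
    ext x; congr 1; ring
  rw [this, h, finrank_euclideanSpace_fin]
  have h2 : Real.pi / (1 / (2 * a)) = 2 * Real.pi * a := by field_simp
  rw [h2, ← Real.rpow_add (by positivity)]
  have : -(d : ℝ) / 2 + d / 2 = 0 := by ring
  rw [this, Real.rpow_zero]

lemma integrable_heatKernel (ha : 0 < a) : Integrable (heatKernel d a) := by
  by_contra h
  have := integral_undef h
  rw [integral_heatKernel ha] at this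
  exact one_ne_zero this

lemma lintegral_heatKernel_sub (ha : 0 < a) (x : E d) :
    ∫⁻ y : E d, ENNReal.ofReal (heatKernel d a (x - y)) = 1 := by
  rw [lintegral_sub_left_eq_self (fun y : E d => ENNReal.ofReal (heatKernel d a y)) x,
    ← ofReal_integral_eq_lintegral_ofReal (integrable_heatKernel ha)
      (ae_of_all _ (heatKernel_nonneg ha)), integral_heatKernel ha, ENNReal.ofReal_one]

/-- Ultracontractivity of the heat semigroup. -/
lemma lintegral_heatKernel_mul_le (ha : 0 < a) {p : ℝ} (hp : 1 ≤ p) {k : E d → ℝ}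
    (hk : Measurable k) (x : E d) :
    ∫⁻ y : E d, ENNReal.ofReal (heatKernel d a (x - y)) * ‖k y‖ₑ ≤
      ENNReal.ofReal (a ^ (-(d / p) / 2)) * eLpNorm k (ENNReal.ofReal p) volume := by
  have hp0 : 0 < p := by linarith
  have hmeas : Measurable fun y : E d => ENNReal.ofReal (heatKernel d a (x - y)) :=
    ((continuous_heatKernel a).measurable.comp (measurable_const.sub measurable_id)).ennreal_ofReal
  -- The kernel is a probability density bounded by `(2πa)^(-d/2)`. Jensen under `ν` followed by
  -- this density bound replaces Hölder's inequality with an explicit norm of the kernel.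
  set ν : Measure (E d) := volume.withDensity fun y => ENNReal.ofReal (heatKernel d a (x - y))
    with hν
  have : IsProbabilityMeasure ν :=
    ⟨by rw [hν, withDensity_apply _ MeasurableSet.univ, Measure.restrict_univ,
      lintegral_heatKernel_sub ha]⟩
  have hνle : ν ≤ ENNReal.ofReal ((2 * Real.pi * a) ^ (-(d : ℝ) / 2)) • volume := by
    rw [← withDensity_const]
    exact withDensity_mono (ae_of_all _ fun y => ENNReal.ofReal_le_ofReal (heatKernel_le ha _))
  have h1 : ∫⁻ y : E d, ENNReal.ofReal (heatKernel d a (x - y)) * ‖k y‖ₑ = eLpNorm k 1 ν := by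
    rw [eLpNorm_one_eq_lintegral_enorm, hν, lintegral_withDensity_eq_lintegral_mul _ hmeas
      hk.enorm]
    rfl
  have hp1 : (1 : ℝ≥0∞) ≤ ENNReal.ofReal p := by simpa using hp
  rw [h1]
  refine (eLpNorm_le_eLpNorm_of_exponent_le hp1 hk.aestronglyMeasurable).trans ?_
  refine (eLpNorm_mono_measure _ hνle).trans ?_
  rw [eLpNorm_smul_measure_of_ne_top ENNReal.ofReal_ne_top, smul_eq_mul]
  gcongr
  rw [ENNReal.toReal_div, ENNReal.toReal_ofReal hp0.le, ENNReal.toReal_one,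
    ENNReal.ofReal_rpow_of_nonneg (by positivity) (by positivity), ← Real.rpow_mul (by positivity),
    Real.mul_rpow (by positivity) ha.le]
  refine ENNReal.ofReal_le_ofReal ?_
  have e1 : -(d : ℝ) / 2 * (1 / p) = -(d / p) / 2 := by field_simp
  rw [e1]
  refine mul_le_of_le_one_left (by positivity) ?_
  refine Real.rpow_le_one_of_one_le_of_nonpos ?_ ?_
  · nlinarith [Real.pi_gt_three]
  · have : 0 ≤ (d : ℝ) / p := by positivity
    linarith

/-- For small increments, factor out `exp (-u²/2)` and use `1 - exp (-x) ≤ x`. Half of the Gaussian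
is spent on absorbing the linear factor `u`; the other half survives on the right. -/
lemma exp_sub_exp_le_of_le {u v : ℝ} (huv : u ≤ v) :
    Real.exp (-u ^ 2 / 2) - Real.exp (-v ^ 2 / 2) ≤
      2 * min 1 (v - u) * Real.exp (-u ^ 2 / 4) := by
  have hE : Real.exp (-u ^ 2 / 2) = Real.exp (-u ^ 2 / 4) * Real.exp (-u ^ 2 / 4) := by
    rw [← Real.exp_add]; congr 1; ring
  have hle1 : Real.exp (-u ^ 2 / 4) ≤ 1 := Real.exp_le_one_iff.2 (by nlinarith [sq_nonneg u])
  have hpos := Real.exp_pos (-u ^ 2 / 4)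
  rcases le_total 1 (v - u) with h | h
  · rw [min_eq_left h]
    nlinarith [Real.exp_pos (-v ^ 2 / 2)]
  · rw [min_eq_right h]
    set δ := v - u with hδ
    have hδ0 : 0 ≤ δ := by linarith
    have h1 : Real.exp (-v ^ 2 / 2) = Real.exp (-u ^ 2 / 2) * Real.exp (-(δ * (2 * u + δ) / 2)) := by
      rw [← Real.exp_add]; congr 1; rw [hδ]; ring
    have h2 : 1 - δ * (2 * u + δ) / 2 ≤ Real.exp (-(δ * (2 * u + δ) / 2)) := by
      linarith [Real.add_one_le_exp (-(δ * (2 * u + δ) / 2))]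
    have h3 : u ≤ Real.exp (u ^ 2 / 4) := by
      nlinarith [Real.add_one_le_exp (u ^ 2 / 4), sq_nonneg (u / 2 - 1)]
    have h4 : Real.exp (-u ^ 2 / 4) * Real.exp (u ^ 2 / 4) = 1 := by
      rw [← Real.exp_add, ← Real.exp_zero]; congr 1; ring
    have h5 : Real.exp (-u ^ 2 / 4) * u ≤ 1 := by nlinarith
    have h6 : Real.exp (-u ^ 2 / 4) * (δ * (2 * u + δ) / 2) ≤ 2 * δ := by
      have h7 := mul_le_mul_of_nonneg_right h5 hδ0
      have h8 := mul_le_mul hle1 (mul_le_mul h le_rfl hδ0 zero_le_one) (by positivity) zero_le_one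
      nlinarith
    calc Real.exp (-u ^ 2 / 2) - Real.exp (-v ^ 2 / 2)
        = Real.exp (-u ^ 2 / 2) * (1 - Real.exp (-(δ * (2 * u + δ) / 2))) := by rw [h1]; ring
      _ ≤ Real.exp (-u ^ 2 / 2) * (δ * (2 * u + δ) / 2) := by gcongr; linarith
      _ = Real.exp (-u ^ 2 / 4) * (Real.exp (-u ^ 2 / 4) * (δ * (2 * u + δ) / 2)) := by
          rw [hE]; ring
      _ ≤ Real.exp (-u ^ 2 / 4) * (2 * δ) := by gcongr
      _ = _ := by ring

/-- Interpolation: `min 1 z ≤ z ^ θ` for every `θ ∈ [0,1]`. Adding both Gaussians makes the bound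
symmetric. -/
lemma abs_exp_sub_exp_le {u v θ : ℝ} (hu : 0 ≤ u) (hv : 0 ≤ v) (hθ0 : 0 ≤ θ) (hθ1 : θ ≤ 1) :
    |Real.exp (-u ^ 2 / 2) - Real.exp (-v ^ 2 / 2)| ≤
      2 * |u - v| ^ θ * (Real.exp (-u ^ 2 / 4) + Real.exp (-v ^ 2 / 4)) := by
  have hmin : ∀ z : ℝ, 0 ≤ z → min 1 z ≤ z ^ θ := by
    intro z hz
    rcases le_total 1 z with h | h
    · exact (min_le_left _ _).trans (Real.one_le_rpow h hθ0)
    · refine (min_le_right _ _).trans ?_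
      simpa using Real.rpow_le_rpow_of_exponent_ge' hz h hθ0 hθ1
  have key : ∀ u v : ℝ, 0 ≤ u → u ≤ v →
      |Real.exp (-u ^ 2 / 2) - Real.exp (-v ^ 2 / 2)| ≤
        2 * |u - v| ^ θ * (Real.exp (-u ^ 2 / 4) + Real.exp (-v ^ 2 / 4)) := by
    intro u v hu huv
    have h0 : Real.exp (-v ^ 2 / 2) ≤ Real.exp (-u ^ 2 / 2) := by
      apply Real.exp_le_exp.2; nlinarith
    rw [abs_of_nonneg (by linarith), abs_sub_comm, abs_of_nonneg (by linarith : 0 ≤ v - u)]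
    refine (exp_sub_exp_le_of_le huv).trans ?_
    have := hmin (v - u) (by linarith)
    gcongr
    linarith [Real.exp_pos (-v ^ 2 / 4)]
  rcases le_total u v with h | h
  · exact key u v hu h
  · rw [abs_sub_comm, abs_sub_comm u v, add_comm]
    exact key v u hv h

/-- The kernel is radial, so the one-dimensional bound at scale `√a` suffices. The halved Gaussian
exponent is that of time `2 * a`, and renormalising it costs `2 ^ (d / 2)`. -/
lemma abs_heatKernel_sub_le (ha : 0 < a) {θ : ℝ} (hθ0 : 0 ≤ θ) (hθ1 : θ ≤ 1) (x h : E d) :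
    |heatKernel d a (x + h) - heatKernel d a x| ≤
      2 * 2 ^ ((d : ℝ) / 2) * ‖h‖ ^ θ * a ^ (-θ / 2) *
        (heatKernel d (2 * a) (x + h) + heatKernel d (2 * a) x) := by
  have hs : 0 < √a := Real.sqrt_pos.2 ha
  have e2 : ∀ z : E d, -‖z‖ ^ 2 / (2 * a) = -(‖z‖ / √a) ^ 2 / 2 := by
    intro z; rw [div_pow, Real.sq_sqrt ha.le]; field_simp
  have e4 : ∀ z : E d, -‖z‖ ^ 2 / (2 * (2 * a)) = -(‖z‖ / √a) ^ 2 / 4 := by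
    intro z; rw [div_pow, Real.sq_sqrt ha.le]; field_simp; norm_num
  have ec : (2 * Real.pi * (2 * a)) ^ (-(d : ℝ) / 2)
      = 2 ^ (-((d : ℝ) / 2)) * (2 * Real.pi * a) ^ (-(d : ℝ) / 2) := by
    rw [← neg_div, ← Real.mul_rpow (by norm_num) (by positivity)]; congr 1; ring
  have e0 : (2 : ℝ) ^ ((d : ℝ) / 2) * 2 ^ (-((d : ℝ) / 2)) = 1 := by
    rw [← Real.rpow_add (by norm_num)]; simp
  unfold heatKernel
  rw [e2, e2, e4, e4, ec, ← mul_sub, abs_mul, abs_of_nonneg (by positivity)]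
  have hb := abs_exp_sub_exp_le (u := ‖x + h‖ / √a) (v := ‖x‖ / √a) (θ := θ) (by positivity)
    (by positivity) hθ0 hθ1
  have hd : |‖x + h‖ / √a - ‖x‖ / √a| ≤ ‖h‖ / √a := by
    rw [← sub_div, abs_div, abs_of_pos hs]
    gcongr
    simpa using abs_norm_sub_norm_le (x + h) x
  have hd' : |‖x + h‖ / √a - ‖x‖ / √a| ^ θ ≤ ‖h‖ ^ θ * a ^ (-θ / 2) := by
    refine (Real.rpow_le_rpow (abs_nonneg _) hd hθ0).trans_eq ?_
    rw [Real.div_rpow (norm_nonneg _) hs.le, Real.sqrt_eq_rpow, ← Real.rpow_mul ha.le, div_eq_mul_inv,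
      ← Real.rpow_neg ha.le]
    congr 2; ring
  set A := Real.exp (-(‖x + h‖ / √a) ^ 2 / 4)
  set B := Real.exp (-(‖x‖ / √a) ^ 2 / 4)
  have hA : 0 < A := Real.exp_pos _
  have hB : 0 < B := Real.exp_pos _
  calc _ ≤ (2 * Real.pi * a) ^ (-(d : ℝ) / 2) * (2 * (‖h‖ ^ θ * a ^ (-θ / 2)) * (A + B)) := by
        refine mul_le_mul_of_nonneg_left (hb.trans ?_) (by positivity)
        gcongr
    _ = (2 ^ ((d : ℝ) / 2) * 2 ^ (-((d : ℝ) / 2))) * ((2 * Real.pi * a) ^ (-(d : ℝ) / 2) *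
          (2 * (‖h‖ ^ θ * a ^ (-θ / 2)) * (A + B))) := by rw [e0, one_mul]
    _ = _ := by ring

/-- Smoothing of increments by the heat semigroup. -/
lemma enorm_integral_heatKernel_smul_sub_le (ha : 0 < a) {p : ℝ} (hp : 1 ≤ p) {θ : ℝ}
    (hθ0 : 0 ≤ θ) (hθ1 : θ ≤ 1) {k : E d → ℝ} (hk : Continuous k) {M : ℝ} (hM : ∀ y, ‖k y‖ ≤ M)
    (x h : E d) :
    ‖∫ y : E d, heatKernel d a (x - y) * (k (y + h) - k y)‖ₑ ≤
      ENNReal.ofReal (4 * 2 ^ ((d : ℝ) / 2)) * ‖h‖ₑ ^ θ * eLpNorm k (ENNReal.ofReal p) volume *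
        ENNReal.ofReal (a ^ (-(d / p + θ) / 2)) := by
  have hint : ∀ (z : E d) (k' : E d → ℝ), Continuous k' → (∀ y, ‖k' y‖ ≤ M) →
      Integrable fun y => heatKernel d a (z - y) * k' y := by
    intro z k' hk' hM'
    exact ((integrable_heatKernel ha).comp_sub_left z).mul_bdd (c := M)
      hk'.aestronglyMeasurable (ae_of_all _ hM')
  -- Translation invariance moves the increment from `k`, which has no regularity to offer, to the
  -- smooth kernel.
  have h1 : ∫ y : E d, heatKernel d a (x - y) * (k (y + h) - k y)
      = ∫ y : E d, (heatKernel d a (x - y + h) - heatKernel d a (x - y)) * k y := by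
    simp_rw [mul_sub, sub_mul]
    rw [integral_sub (hint x _ (by fun_prop) fun y => hM _) (hint x _ hk hM), integral_sub _
      (hint x _ hk hM)]
    · congr 1
      rw [← integral_add_right_eq_self (fun y => heatKernel d a (x - y + h) * k y) h]
      congr 1; ext y; congr 2; abel
    · have := hint (x + h) k hk hM
      refine this.congr (ae_of_all _ fun y => ?_)
      simp only
      congr 2; abel
  rw [h1]
  refine (enorm_integral_le_lintegral_enorm _).trans ?_
  set c : ℝ := 2 * 2 ^ ((d : ℝ) / 2) * ‖h‖ ^ θ * a ^ (-θ / 2) with hc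
  have hc0 : 0 ≤ c := by positivity
  have h2a : 0 < 2 * a := by positivity
  have hm : ∀ z : E d, Measurable fun y : E d =>
      ENNReal.ofReal (heatKernel d (2 * a) (z - y)) * ‖k y‖ₑ := by
    intro z
    exact (((continuous_heatKernel _).measurable.comp
      (measurable_const.sub measurable_id)).ennreal_ofReal).mul hk.measurable.enorm
  have hpt : ∀ y : E d, ‖(heatKernel d a (x - y + h) - heatKernel d a (x - y)) * k y‖ₑ ≤
      ENNReal.ofReal c * (ENNReal.ofReal (heatKernel d (2 * a) (x + h - y)) * ‖k y‖ₑ +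
        ENNReal.ofReal (heatKernel d (2 * a) (x - y)) * ‖k y‖ₑ) := by
    intro y
    rw [enorm_mul, ← add_mul, ← mul_assoc]
    gcongr
    rw [← ENNReal.ofReal_add (heatKernel_nonneg h2a _) (heatKernel_nonneg h2a _),
      ← ENNReal.ofReal_mul hc0, Real.enorm_eq_ofReal_abs]
    refine ENNReal.ofReal_le_ofReal ((abs_heatKernel_sub_le ha hθ0 hθ1 (x - y) h).trans_eq ?_)
    rw [show x + h - y = x - y + h by abel]
  refine (lintegral_mono hpt).trans ?_
  rw [lintegral_const_mul' _ _ ENNReal.ofReal_ne_top, lintegral_add_left (hm _)]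
  have hb := fun z => lintegral_heatKernel_mul_le h2a hp hk.measurable z
  refine (mul_le_mul_right (add_le_add (hb _) (hb _)) _).trans ?_
  rw [← two_mul]
  have h3 : (2 * a) ^ (-(d / p) / 2) ≤ a ^ (-(d / p) / 2) := by
    refine Real.rpow_le_rpow_of_nonpos ha (by linarith) ?_
    have : 0 ≤ (d : ℝ) / p := by positivity
    linarith
  have h4 : ‖h‖ₑ ^ θ = ENNReal.ofReal (‖h‖ ^ θ) := by
    rw [← ENNReal.ofReal_rpow_of_nonneg (norm_nonneg _) hθ0, ofReal_norm]
  have h5 : a ^ (-(d / p + θ) / 2) = a ^ (-θ / 2) * a ^ (-(d / p) / 2) := by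
    rw [← Real.rpow_add ha]; congr 1; ring
  calc _ ≤ ENNReal.ofReal c * (2 * (ENNReal.ofReal (a ^ (-(d / p) / 2)) *
        eLpNorm k (ENNReal.ofReal p) volume)) := by gcongr
    _ = _ := by
      rw [h4, h5, hc, ENNReal.ofReal_mul (by positivity), ENNReal.ofReal_mul (by positivity),
        ENNReal.ofReal_mul (by positivity), ENNReal.ofReal_mul (by positivity),
        ENNReal.ofReal_mul (by positivity)]
      rw [show ENNReal.ofReal 2 = 2 by simp, show ENNReal.ofReal 4 = 2 * 2 by norm_num]
      ring

end HeatKernel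

/-- The smoothing bound with `ρ = ∞` holds only for almost every shift, whereas it must be evaluated
at random shifts whose law may be singular. -/
lemma le_of_ae_le_of_continuous {X : Type*} [TopologicalSpace X] [MeasurableSpace X]
    {μ : Measure X} [μ.IsOpenPosMeasure] {F : X → ℝ≥0∞} (hF : Continuous F) {c : ℝ≥0∞}
    (h : ∀ᵐ x ∂μ, F x ≤ c) (x : X) : F x ≤ c := by
  have ho : IsOpen {x | c < F x} := isOpen_lt continuous_const hF
  have h0 : μ {x | c < F x} = 0 := by
    simpa [ae_iff] using h
  have := (ho.measure_eq_zero_iff μ).1 h0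
  by_contra hx
  have : x ∈ {x | c < F x} := not_le.1 hx
  simp_all

/-- Integrating out a variable independent of a sub-σ-algebra. -/
lemma setLIntegral_of_indep {Ω β γ : Type*} {m mΩ : MeasurableSpace Ω} {P : Measure Ω}
    [IsProbabilityMeasure P] [MeasurableSpace β] [MeasurableSpace γ] (hm : m ≤ mΩ) {Z : Ω → γ}
    (hZ : Measurable Z) (hind : Indep (MeasurableSpace.comap Z inferInstance) m P)
    {ζ : Ω → β} (hζ : Measurable[m] ζ) {B : Set Ω} (hB : MeasurableSet[m] B)
    {Φ : β × γ → ℝ≥0∞} (hΦ : Measurable Φ) :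
    ∫⁻ ω in B, Φ (ζ ω, Z ω) ∂P = ∫⁻ ω in B, ∫⁻ ω', Φ (ζ ω, Z ω') ∂P ∂P := by
  set χ : Ω → ℝ≥0∞ := B.indicator fun _ => 1
  have hχ : Measurable[m] χ := (@measurable_const _ _ _ m 1).indicator hB
  -- Carrying the indicator of `B` along with `ζ` turns the restriction to `B` into part of one
  -- variable independent of `Z`.
  set W : Ω → ℝ≥0∞ × β := fun ω => (χ ω, ζ ω)
  have hW : Measurable[m] W := hχ.prodMk hζ
  have hWZ : W ⟂ᵢ[P] Z := by
    rw [IndepFun_iff_Indep]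
    exact (indep_of_indep_of_le_right hind hW.comap_le).symm
  have hprod := (indepFun_iff_map_prod_eq_prod_map_map (hW.mono hm le_rfl).aemeasurable
    hZ.aemeasurable).1 hWZ
  have hΨ : Measurable fun z : (ℝ≥0∞ × β) × γ => z.1.1 * Φ (z.1.2, z.2) := by fun_prop
  have hW' : Measurable W := hW.mono hm le_rfl
  have hind : ∀ F : Ω → ℝ≥0∞, ∫⁻ ω in B, F ω ∂P = ∫⁻ ω, χ ω * F ω ∂P := by
    intro F
    rw [← lintegral_indicator (hm _ hB)]
    congr 1; ext ω
    by_cases h : ω ∈ B <;> simp [χ, h]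
  rw [hind, hind]
  calc ∫⁻ ω, χ ω * Φ (ζ ω, Z ω) ∂P
      = ∫⁻ z, z.1.1 * Φ (z.1.2, z.2) ∂(P.map fun ω => (W ω, Z ω)) :=
        (lintegral_map hΨ (hW'.prodMk hZ)).symm
    _ = ∫⁻ w, ∫⁻ z, w.1 * Φ (w.2, z) ∂(P.map Z) ∂(P.map W) := by
        rw [hprod, lintegral_prod _ hΨ.aemeasurable]
    _ = ∫⁻ ω, ∫⁻ z, χ ω * Φ (ζ ω, z) ∂(P.map Z) ∂P := by
        rw [lintegral_map hΨ.lintegral_prod_right hW']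
    _ = _ := by
        refine lintegral_congr fun ω => ?_
        have h1 : Measurable fun z => Φ (ζ ω, z) := hΦ.comp measurable_prodMk_left
        rw [lintegral_const_mul _ h1, lintegral_map h1 hZ]

lemma measurable_innovation {d : ℕ} {Ω : Type*} [mΩ : MeasurableSpace Ω] {P : Measure Ω}
    {ℱ : Filtration ℝ mΩ} {Y : ℝ → Ω → E d} {t : ℝ} (hY : Measurable (Y t)) (s : ℝ) :
    Measurable (innovation P ℱ Y s t) :=
  hY.sub (stronglyMeasurable_condExp.mono (ℱ.le s)).measurable

/-! ### Consequences of the noise assumption for frozen shifts. -/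

section Noise

variable {d : ℕ} {Ω : Type*} [mΩ : MeasurableSpace Ω] {P : Measure Ω} [IsProbabilityMeasure P]
  {ℱ : Filtration ℝ mΩ} {H : ℝ} {κ : ℝ≥0} {K : ℝ → ℝ≥0∞ → ℝ≥0} {Y : ℝ → Ω → E d}

lemma continuous_integral_comp_add {Z : Ω → E d} (hZ : Measurable Z) {k : E d → ℝ}
    (hk : Continuous k) {M : ℝ} (hM : ∀ y, ‖k y‖ ≤ M) :
    Continuous fun z : E d => ∫ ω, k (Z ω + z) ∂P := by
  refine continuous_of_dominated (bound := fun _ => M) (fun z => ?_)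
    (fun z => ae_of_all _ fun ω => hM _) (integrable_const _) (ae_of_all _ fun ω => by fun_prop)
  exact (hk.measurable.comp (hZ.add_const z)).aestronglyMeasurable

/-- The smoothing bound with `ρ = ∞` for continuous scalar functions, at every point. -/
lemma NoiseAssumption.enorm_integral_le (hN : NoiseAssumption P ℱ H κ K Y) (hd : 1 ≤ d)
    {β : ℝ} (hβ : β < 0) {k : E d → ℝ} (hk : Continuous k) {M : ℝ} (hM : ∀ y, ‖k y‖ ≤ M)
    {L : ℝ≥0∞} (hL : ∀ a ∈ Set.Ioc (0 : ℝ) 1, ∀ x : E d,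
      ‖∫ y : E d, heatKernel d a (x - y) * k y‖ₑ ≤ L * ENNReal.ofReal (a ^ (β / 2)))
    {s t : ℝ} (hY : Measurable (Y t)) (hs : 0 ≤ s) (hst : s < t) (ht : t ≤ 1) (z : E d) :
    ‖∫ ω, k (innovation P ℱ Y s t ω + z) ∂P‖ₑ ≤
      K β ∞ * L * ENNReal.ofReal ((t - s) ^ (β * H)) := by
  -- The assumption concerns vector fields, so the scalar `k` is put along a unit vector; one exists
  -- because `1 ≤ d`.
  set e : E d := EuclideanSpace.single (⟨0, hd⟩ : Fin d) (1 : ℝ)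
  have he : ‖e‖ = 1 := by simp [e]
  have hee : ‖e‖ₑ = 1 := by rw [← ofReal_norm, he, ENNReal.ofReal_one]
  have hsm := hN.smoothing β ∞ hβ le_top (fun y => k y • e) (by fun_prop)
    ⟨M, fun y => by rw [norm_smul, he, mul_one]; exact hM y⟩ s t hs hst ht
  have hbes : besovNorm β ∞ (fun y => k y • e) ≤ L := by
    refine iSup₂_le fun a ha => ?_
    have : eLpNorm (fun x : E d => ∫ y : E d, heatKernel d a (x - y) • k y • e) ∞ volume ≤
        L * ENNReal.ofReal (a ^ (β / 2)) := by
      rw [eLpNorm_exponent_top]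
      refine essSup_le_of_ae_le _ (ae_of_all _ fun x => ?_)
      simp_rw [smul_smul]
      rw [integral_smul_const, enorm_smul, hee, mul_one]
      exact hL a ha x
    refine (mul_le_mul_right this _).trans_eq ?_
    rw [mul_left_comm, ← ENNReal.ofReal_mul (Real.rpow_nonneg ha.1.le _), ← Real.rpow_add ha.1]
    simp [neg_div]
  have hcont : Continuous fun z : E d => ‖∫ ω, k (innovation P ℱ Y s t ω + z) ∂P‖ₑ :=
    (continuous_integral_comp_add (measurable_innovation hY s) hk hM).enorm
  refine le_of_ae_le_of_continuous (μ := volume) hcont ?_ z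
  rw [eLpNorm_exponent_top] at hsm
  filter_upwards [ae_le_eLpNormEssSup (μ := (volume : Measure (E d)))
    (f := fun x : E d => ∫ ω, k (innovation P ℱ Y s t ω + x) • e ∂P)] with x hx
  rw [integral_smul_const, enorm_smul, hee, mul_one] at hx
  refine hx.trans (hsm.trans ?_)
  gcongr

variable {p : ℝ} {g : E d → ℝ} {M : ℝ} {u r : ℝ} {B : Set Ω} {ξ η : Ω → E d}

/-- `Y r` splits into its innovation after `u`, independent of `ℱ u`, and its `ℱ u`-conditional
mean, which joins `ξ` in the shift. -/
lemma setLIntegral_comp_add_eq (hN : NoiseAssumption P ℱ H κ K Y) (hg : Continuous g)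
    (hg0 : ∀ y, 0 ≤ g y) (hM : ∀ y, ‖g y‖ ≤ M) (hY : Measurable (Y r)) (hu : 0 ≤ u) (hur : u < r)
    (hr : r ≤ 1) (hξ : Measurable[ℱ u] ξ) (hB : MeasurableSet[ℱ u] B) :
    ∫⁻ ω in B, ENNReal.ofReal (g (ξ ω + Y r ω)) ∂P =
      ∫⁻ ω in B, ENNReal.ofReal (∫ ω', g (innovation P ℱ Y u r ω' +
        (ξ ω + (P[Y r | ℱ u]) ω)) ∂P) ∂P := by
  have hZ := measurable_innovation (P := P) (ℱ := ℱ) hY u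
  have hce : Measurable[ℱ u] (P[Y r | ℱ u]) := stronglyMeasurable_condExp.measurable
  have hζ : Measurable[ℱ u] fun ω => ξ ω + (P[Y r | ℱ u]) ω := hξ.add hce
  have h := setLIntegral_of_indep (ℱ.le u) hZ (hN.indep u r hu hur.le hr) hζ hB
    (Φ := fun z => ENNReal.ofReal (g (z.2 + z.1))) (by fun_prop)
  have h1 : ∀ ω, innovation P ℱ Y u r ω + (ξ ω + (P[Y r | ℱ u]) ω) = ξ ω + Y r ω := by
    intro ω; simp only [innovation]; abel
  simp only [h1] at h
  rw [h]
  refine lintegral_congr fun ω => ?_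
  rw [ofReal_integral_eq_lintegral_ofReal _ (ae_of_all _ fun _ => hg0 _)]
  exact Integrable.of_bound (hg.measurable.comp (hZ.add_const _)).aestronglyMeasurable M
    (ae_of_all _ fun _ => hM _)

/-- Ultracontractivity embeds `L_p` into the Besov space of regularity `-d/p` with `ρ = ∞`, and the
smoothing bound then holds uniformly in the shift. -/
lemma NoiseAssumption.setLIntegral_comp_add_le (hN : NoiseAssumption P ℱ H κ K Y) (hd : 1 ≤ d)
    (hp : 1 ≤ p) (hg : Continuous g) (hg0 : ∀ y, 0 ≤ g y) (hM : ∀ y, ‖g y‖ ≤ M)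
    (hY : Measurable (Y r)) (hu : 0 ≤ u) (hur : u < r) (hr : r ≤ 1)
    (hξ : AEStronglyMeasurable[ℱ u] ξ P) (hB : MeasurableSet[ℱ u] B) :
    ∫⁻ ω in B, ENNReal.ofReal (g (ξ ω + Y r ω)) ∂P ≤
      K (-(d / p)) ∞ * eLpNorm g (ENNReal.ofReal p) volume *
        ENNReal.ofReal ((r - u) ^ (-(d / p) * H)) * P B := by
  obtain ⟨ξ', hξ', hξξ'⟩ := hξ
  have hcongr : ∫⁻ ω in B, ENNReal.ofReal (g (ξ ω + Y r ω)) ∂P =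
      ∫⁻ ω in B, ENNReal.ofReal (g (ξ' ω + Y r ω)) ∂P := by
    refine lintegral_congr_ae (ae_restrict_of_ae ?_)
    filter_upwards [hξξ'] with ω h
    rw [h]
  rw [hcongr, setLIntegral_comp_add_eq hN hg hg0 hM hY hu hur hr hξ'.measurable hB]
  have hdp : 0 < (d : ℝ) / p := by
    have : (0 : ℝ) < d := by exact_mod_cast hd
    positivity
  refine (lintegral_mono fun ω => ?_).trans_eq (setLIntegral_const _ _)
  have := hN.enorm_integral_le hd (β := -(d / p)) (by linarith) hg hM
    (L := eLpNorm g (ENNReal.ofReal p) volume) (fun a ha x => ?_) hY hu hur hr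
    (ξ' ω + (P[Y r | ℱ u]) ω)
  · refine le_trans ?_ this
    rw [Real.enorm_eq_ofReal_abs]
    exact ENNReal.ofReal_le_ofReal (le_abs_self _)
  · refine (enorm_integral_le_lintegral_enorm _).trans ?_
    rw [mul_comm]
    refine le_trans (lintegral_mono fun y => ?_) (lintegral_heatKernel_mul_le ha.1 hp hg.measurable x)
    rw [enorm_mul, Real.enorm_of_nonneg (heatKernel_nonneg ha.1 _)]

/-- The difference `g (· + h) - g` has Besov norm of regularity `-(d/p + θ)` at most a constant
times `‖h‖^θ ‖g‖_p`: spatial regularity `θ` in the shift is bought with an extra time singularity of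
order `θH`. -/
lemma NoiseAssumption.setLIntegral_comp_add_le_add (hN : NoiseAssumption P ℱ H κ K Y) (hd : 1 ≤ d)
    (hp : 1 ≤ p) {θ : ℝ} (hθ0 : 0 ≤ θ) (hθ1 : θ ≤ 1) (hg : Continuous g) (hg0 : ∀ y, 0 ≤ g y)
    (hM : ∀ y, ‖g y‖ ≤ M) (hY : Measurable (Y r)) (hu : 0 ≤ u) (hur : u < r) (hr : r ≤ 1)
    (hξ : AEStronglyMeasurable[ℱ u] ξ P) (hη : AEStronglyMeasurable[ℱ u] η P)
    (hB : MeasurableSet[ℱ u] B) :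
    ∫⁻ ω in B, ENNReal.ofReal (g (ξ ω + Y r ω)) ∂P ≤
      ∫⁻ ω in B, ENNReal.ofReal (g (η ω + Y r ω)) ∂P +
      K (-(d / p + θ)) ∞ * ENNReal.ofReal (4 * 2 ^ ((d : ℝ) / 2)) *
        eLpNorm g (ENNReal.ofReal p) volume *
        ENNReal.ofReal ((r - u) ^ (-(d / p + θ) * H)) * ∫⁻ ω in B, ‖ξ ω - η ω‖ₑ ^ θ ∂P := by
  obtain ⟨ξ', hξ', hξξ'⟩ := hξ
  obtain ⟨η', hη', hηη'⟩ := hη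
  have hcongr : ∀ ξ ξ' : Ω → E d, ξ =ᵐ[P] ξ' → ∫⁻ ω in B, ENNReal.ofReal (g (ξ ω + Y r ω)) ∂P =
      ∫⁻ ω in B, ENNReal.ofReal (g (ξ' ω + Y r ω)) ∂P := by
    intro ξ ξ' hξξ'
    refine lintegral_congr_ae (ae_restrict_of_ae ?_)
    filter_upwards [hξξ'] with ω h
    rw [h]
  have hcongr2 : ∫⁻ ω in B, ‖ξ ω - η ω‖ₑ ^ θ ∂P = ∫⁻ ω in B, ‖ξ' ω - η' ω‖ₑ ^ θ ∂P := by
    refine lintegral_congr_ae (ae_restrict_of_ae ?_)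
    filter_upwards [hξξ', hηη'] with ω h h'
    rw [h, h']
  have hce : StronglyMeasurable (P[Y r | ℱ u]) := stronglyMeasurable_condExp.mono (ℱ.le u)
  have hZ := measurable_innovation (P := P) (ℱ := ℱ) hY u
  have hFc := continuous_integral_comp_add (P := P) hZ hg hM
  have hη'' := (hη'.mono (ℱ.le u)).measurable
  have hξ'' := (hξ'.mono (ℱ.le u)).measurable
  rw [hcongr ξ ξ' hξξ', hcongr η η' hηη', hcongr2,
    setLIntegral_comp_add_eq hN hg hg0 hM hY hu hur hr hξ'.measurable hB,
    setLIntegral_comp_add_eq hN hg hg0 hM hY hu hur hr hη'.measurable hB,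
    ← lintegral_const_mul _ (by fun_prop), ← lintegral_add_left]
  swap
  · exact (hFc.measurable.comp (hη''.add hce.measurable)).ennreal_ofReal
  have hdp : 0 < (d : ℝ) / p := by
    have : (0 : ℝ) < d := by exact_mod_cast hd
    positivity
  refine lintegral_mono fun ω => ?_
  set z' := η' ω + (P[Y r | ℱ u]) ω with hz'
  set h := ξ' ω - η' ω with hh
  have hz : ξ' ω + (P[Y r | ℱ u]) ω = z' + h := by rw [hz', hh]; abel
  have hint : ∀ z : E d, Integrable (fun ω' => g (innovation P ℱ Y u r ω' + z)) P := fun z =>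
    Integrable.of_bound (hg.measurable.comp (hZ.add_const _)).aestronglyMeasurable M
      (ae_of_all _ fun _ => hM _)
  have hk : Continuous fun y => g (y + h) - g y := by fun_prop
  have := hN.enorm_integral_le hd (β := -(d / p + θ)) (by linarith) hk (M := M + M)
    (fun y => (norm_sub_le _ _).trans (add_le_add (hM _) (hM _)))
    (L := ENNReal.ofReal (4 * 2 ^ ((d : ℝ) / 2)) * ‖h‖ₑ ^ θ * eLpNorm g (ENNReal.ofReal p) volume)
    (fun a ha x => enorm_integral_heatKernel_smul_sub_le ha.1 hp hθ0 hθ1 hg hM x h) hY hu hur hr z'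
  have hsub : ∫ ω', (g (innovation P ℱ Y u r ω' + z' + h) - g (innovation P ℱ Y u r ω' + z')) ∂P =
      ∫ ω', g (innovation P ℱ Y u r ω' + (z' + h)) ∂P -
      ∫ ω', g (innovation P ℱ Y u r ω' + z') ∂P := by
    simp_rw [add_assoc]
    exact integral_sub (hint _) (hint _)
  rw [hsub] at this
  rw [hz]
  set F1 := ∫ ω', g (innovation P ℱ Y u r ω' + (z' + h)) ∂P
  set F2 := ∫ ω', g (innovation P ℱ Y u r ω' + z') ∂P
  have hF2 : 0 ≤ F2 := integral_nonneg fun _ => hg0 _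
  calc ENNReal.ofReal F1 ≤ ENNReal.ofReal (F2 + |F1 - F2|) :=
        ENNReal.ofReal_le_ofReal (by linarith [le_abs_self (F1 - F2)])
    _ = ENNReal.ofReal F2 + ‖F1 - F2‖ₑ := by
        rw [ENNReal.ofReal_add hF2 (abs_nonneg _), Real.enorm_eq_ofReal_abs]
    _ ≤ _ := by
        refine add_le_add le_rfl (this.trans_eq ?_)
        ring

end Noise

/-! ### Sums over partitions, Hölder's inequality, and measurability. -/

section Tools

lemma sum_setLIntegral_Ioc (F : ℝ → ℝ≥0∞) {a : ℕ → ℝ} (ha : Monotone a) (n : ℕ) :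
    ∑ i ∈ Finset.range n, ∫⁻ r in Set.Ioc (a i) (a (i + 1)), F r =
      ∫⁻ r in Set.Ioc (a 0) (a n), F r := by
  induction n with
  | zero => simp
  | succ n ih =>
    rw [Finset.sum_range_succ, ih, ← lintegral_union measurableSet_Ioc,
      Set.Ioc_union_Ioc_eq_Ioc (ha (Nat.zero_le n)) (ha n.le_succ)]
    exact Set.Ioc_disjoint_Ioc_of_le le_rfl

lemma setLIntegral_Ioc_add (F : ℝ → ℝ≥0∞) {a b c : ℝ} (hab : a ≤ b) (hbc : b ≤ c) :
    (∫⁻ r in Set.Ioc a b, F r) + ∫⁻ r in Set.Ioc b c, F r = ∫⁻ r in Set.Ioc a c, F r := by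
  rw [← lintegral_union measurableSet_Ioc (Set.Ioc_disjoint_Ioc_of_le le_rfl),
    Set.Ioc_union_Ioc_eq_Ioc hab hbc]

lemma sum_range_two_mul {M : Type*} [AddCommMonoid M] (f : ℕ → M) (n : ℕ) :
    ∑ i ∈ Finset.range (2 * n), f i = ∑ i ∈ Finset.range n, (f (2 * i) + f (2 * i + 1)) := by
  induction n with
  | zero => simp
  | succ n ih =>
    rw [Finset.sum_range_succ, ← ih, show 2 * (n + 1) = 2 * n + 1 + 1 by ring,
      Finset.sum_range_succ, Finset.sum_range_succ, add_assoc]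

/-- Hölder with three factors for the counting measure. The third factor is the constant `1`, whence
the power of the number of terms. -/
lemma sum_rpow_mul_rpow_le (x y : ℕ → ℝ≥0∞) {α β : ℝ} (hα : 0 ≤ α) (hβ : 0 ≤ β)
    (hαβ : α + β ≤ 1) (n : ℕ) :
    ∑ i ∈ Finset.range n, x i ^ α * y i ^ β ≤
      (∑ i ∈ Finset.range n, x i) ^ α * (∑ i ∈ Finset.range n, y i) ^ β *
        (n : ℝ≥0∞) ^ (1 - α - β) := by
  have h := ENNReal.lintegral_prod_norm_pow_le (μ := (Measure.count : Measure (Fin n)))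
    (Finset.univ : Finset (Fin 3)) (f := ![fun i => x i, fun i => y i, fun _ => 1])
    (fun i _ => Measurable.aemeasurable (measurable_of_finite _)) (p := ![α, β, 1 - α - β])
    (by simp [Fin.sum_univ_three]) (by
      intro i _
      fin_cases i <;> simp <;> linarith)
  simp only [lintegral_count, tsum_fintype, Fin.prod_univ_three, Matrix.cons_val_zero,
    Matrix.cons_val_one, Matrix.cons_val_two, Matrix.tail_cons, Matrix.head_cons,
    ENNReal.one_rpow, mul_one, Finset.sum_const, Finset.card_univ,
    Fintype.card_fin, nsmul_eq_mul] at h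
  rw [Finset.sum_range, Finset.sum_range, Finset.sum_range]
  exact h

lemma lintegral_rpow_le_of_le_one {Ω : Type*} [MeasurableSpace Ω] (μ : Measure Ω) {F : Ω → ℝ≥0∞}
    (hF : AEMeasurable F μ) {θ : ℝ} (hθ0 : 0 ≤ θ) (hθ1 : θ ≤ 1) :
    ∫⁻ ω, F ω ^ θ ∂μ ≤ μ Set.univ ^ (1 - θ) * (∫⁻ ω, F ω ∂μ) ^ θ := by
  have h := ENNReal.lintegral_mul_norm_pow_le (μ := μ) hF (aemeasurable_const (b := (1 : ℝ≥0∞)))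
    hθ0 (sub_nonneg.2 hθ1) (by ring)
  simpa [mul_comm] using h

/-- The constant of Hölder's inequality in time against the singular weight `(r - u) ^ (-c)`. -/
def timeConst (q c : ℝ) : ℝ≥0 := Real.toNNReal ((1 / (1 - c * (q / (q - 1)))) ^ (1 - 1 / q))

lemma setLIntegral_Ioc_rpow {c u t : ℝ} (hc : c < 1) (hut : u ≤ t) :
    ∫⁻ r in Set.Ioc u t, ENNReal.ofReal ((r - u) ^ (-c)) =
      ENNReal.ofReal ((t - u) ^ (1 - c) / (1 - c)) := by
  have hi : IntervalIntegrable (fun r : ℝ => (r - u) ^ (-c)) volume u t := by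
    have := (intervalIntegral.intervalIntegrable_rpow' (a := 0) (b := t - u) (r := -c)
      (by linarith)).comp_sub_right u
    simpa using this
  rw [← ofReal_integral_eq_lintegral_ofReal
    ((intervalIntegrable_iff_integrableOn_Ioc_of_le hut).1 hi)]
  · rw [← intervalIntegral.integral_of_le hut,
      intervalIntegral.integral_comp_sub_right (fun r => r ^ (-c)) u,
      integral_rpow (Or.inl (by linarith))]
    congr 1
    rw [sub_self, Real.zero_rpow (by linarith), sub_zero, neg_add_eq_sub]
  · refine (ae_restrict_iff' measurableSet_Ioc).2 (ae_of_all _ fun r hr => ?_)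
    exact Real.rpow_nonneg (by linarith [hr.1]) _

/-- The condition on `c` says that `c` times the exponent conjugate to `q` is below `1`, so the
singular weight has a finite dual norm. -/
lemma setLIntegral_mul_rpow_le {q c : ℝ} (hq : 1 < q) (hc : c < 1 - 1 / q)
    {N : ℝ → ℝ≥0∞} (hN : Measurable N) {u t : ℝ} (hut : u ≤ t) :
    ∫⁻ r in Set.Ioc u t, N r * ENNReal.ofReal ((r - u) ^ (-c)) ≤
      timeConst q c * (∫⁻ r in Set.Ioc u t, N r ^ q) ^ (1 / q) *
        ENNReal.ofReal ((t - u) ^ (1 - 1 / q - c)) := by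
  have hq' : 0 < q - 1 := by linarith
  have hconj : q.HolderConjugate (q / (q - 1)) := Real.HolderConjugate.conjExponent hq
  set q' := q / (q - 1) with hq'def
  have hq'pos : 0 < q' := by positivity
  have hinv : 1 / q' = 1 - 1 / q := by rw [hq'def]; field_simp
  have hcq : c * q' < 1 := by
    rw [← hinv, lt_div_iff₀ hq'pos] at hc; exact hc
  have hm : Measurable fun r : ℝ => ENNReal.ofReal ((r - u) ^ (-c)) := by fun_prop
  have h := ENNReal.lintegral_mul_le_Lp_mul_Lq (volume.restrict (Set.Ioc u t)) hconj
    hN.aemeasurable hm.aemeasurable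
  simp only [Pi.mul_apply] at h
  refine h.trans ?_
  have h2 : ∫⁻ r in Set.Ioc u t, ENNReal.ofReal ((r - u) ^ (-c)) ^ q' =
      ENNReal.ofReal ((t - u) ^ (1 - c * q') / (1 - c * q')) := by
    rw [← setLIntegral_Ioc_rpow hcq hut]
    refine setLIntegral_congr_fun measurableSet_Ioc fun r hr => ?_
    have : 0 ≤ r - u := by linarith [hr.1]
    rw [ENNReal.ofReal_rpow_of_nonneg (by positivity) hq'pos.le, ← Real.rpow_mul this, neg_mul]
  have htu : 0 ≤ t - u := by linarith
  have h1c : 0 < 1 - c * q' := by linarith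
  rw [h2, ENNReal.ofReal_rpow_of_nonneg (by positivity) (by positivity), mul_comm,
    div_eq_inv_mul, Real.mul_rpow (by positivity) (by positivity),
    ENNReal.ofReal_mul (by positivity), ← Real.rpow_mul htu, timeConst, ← one_div, hinv]
  have e : (1 - c * q') * (1 - 1 / q) = 1 - 1 / q - c := by
    rw [← hinv]; field_simp
  rw [e, ENNReal.ofReal, mul_right_comm]

lemma measurable_eLpNorm_section {X Y' : Type*} [MeasurableSpace X] [MeasurableSpace Y']
    {F : Type*} [NormedAddCommGroup F] [MeasurableSpace F] [OpensMeasurableSpace F]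
    {μ : Measure Y'} [SFinite μ] {g : X → Y' → F} (hg : Measurable (Function.uncurry g)) {p : ℝ}
    (hp : 0 < p) : Measurable fun r => eLpNorm (g r) (ENNReal.ofReal p) μ := by
  have h0 : ENNReal.ofReal p ≠ 0 := by simpa using hp
  simp_rw [eLpNorm_eq_lintegral_rpow_enorm_toReal h0 ENNReal.ofReal_ne_top,
    ENNReal.toReal_ofReal hp.le]
  have h : Measurable (Function.uncurry fun (x : X) (y : Y') => ‖g x y‖ₑ ^ p) :=
    hg.enorm.pow_const p
  exact h.lintegral_prod_right.pow_const _

end Tools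

/-- The integral of the density `v` over `(a,b]`. -/
def accum {Ω : Type*} (v : ℝ → Ω → ℝ≥0∞) (a b : ℝ) (ω : Ω) : ℝ≥0∞ := ∫⁻ r in Set.Ioc a b, v r ω

lemma accum_mono {Ω : Type*} (v : ℝ → Ω → ℝ≥0∞) {a a' b b' : ℝ} (ha : a' ≤ a) (hb : b ≤ b') (ω : Ω) :
    accum v a b ω ≤ accum v a' b' ω :=
  lintegral_mono_set (Set.Ioc_subset_Ioc ha hb)

lemma measurable_accum {Ω : Type*} [MeasurableSpace Ω] {v : ℝ → Ω → ℝ≥0∞}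
    (hv : Measurable (Function.uncurry v)) (a b : ℝ) : Measurable (accum v a b) := by
  have h : Measurable (Function.uncurry fun ω r => v r ω) := hv.comp measurable_swap
  exact h.lintegral_prod_right (ν := volume.restrict (Set.Ioc a b))

/-- A path `φ` with continuous trajectories, adapted up to null sets on `[0,1]`, whose increments
are controlled by the integral of the density `v`. -/
structure ControlledPath {d : ℕ} {Ω : Type*} [mΩ : MeasurableSpace Ω] (P : Measure Ω)
    (ℱ : Filtration ℝ mΩ) (φ : ℝ → Ω → E d) (v : ℝ → Ω → ℝ≥0∞) : Prop where
  cont : ∀ ω, Continuous fun r => φ r ω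
  meas : ∀ r, Measurable (φ r)
  adapted : ∀ r ∈ Set.Icc (0 : ℝ) 1, AEStronglyMeasurable[ℱ r] (φ r) P
  measv : Measurable (Function.uncurry v)
  control : ∀ᵐ ω ∂P, ∀ a b : ℝ, 0 ≤ a → a ≤ b → b ≤ 1 →
    ‖φ b ω - φ a ω‖ₑ ≤ accum v a b ω

/-! ### Dyadic sewing for a continuous integrand. -/

section Sewing

variable {d : ℕ} {Ω : Type*} [mΩ : MeasurableSpace Ω] {P : Measure Ω} [IsProbabilityMeasure P]
  {ℱ : Filtration ℝ mΩ} {H : ℝ} {κ : ℝ≥0} {K : ℝ → ℝ≥0∞ → ℝ≥0} {Y φ : ℝ → Ω → E d}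
  {v : ℝ → Ω → ℝ≥0∞} {p q θ M : ℝ} {g : ℝ → E d → ℝ} {B : Set Ω} {s t : ℝ}

lemma measurable_uncurry_setLIntegral {F : ℝ → Ω → ℝ≥0∞} (hF : Measurable (Function.uncurry F)) :
    Measurable fun r => ∫⁻ ω in B, F r ω ∂P :=
  hF.lintegral_prod_right (ν := P.restrict B)

/-- The coarsest level of the dyadic scheme: the path is frozen at the initial time on the whole
interval. -/
lemma frozen_integral_le (hN : NoiseAssumption P ℱ H κ K Y) (hd : 1 ≤ d) (hp : 1 ≤ p) (hq : 1 < q)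
    (hc : d / p * H < 1 - 1 / q) (hY : Measurable (Function.uncurry Y))
    (hφ : ControlledPath P ℱ φ v) (hg : Continuous (Function.uncurry g))
    (hg0 : ∀ r y, 0 ≤ g r y) (hM : ∀ r y, ‖g r y‖ ≤ M)
    (hs : 0 ≤ s) (hst : s ≤ t) (ht : t ≤ 1) (hB : MeasurableSet[ℱ s] B) :
    ∫⁻ r in Set.Ioc s t, ∫⁻ ω in B, ENNReal.ofReal (g r (φ s ω + Y r ω)) ∂P ≤
      K (-(d / p)) ∞ * timeConst q (d / p * H) *
      (∫⁻ r in Set.Ioc s t, eLpNorm (g r) (ENNReal.ofReal p) volume ^ q) ^ (1 / q) *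
        (ENNReal.ofReal ((t - s) ^ (1 - 1 / q - d / p * H)) * P B) := by
  have hmN : Measurable fun r => eLpNorm (g r) (ENNReal.ofReal p) volume :=
    measurable_eLpNorm_section hg.measurable (by linarith)
  have h1 : ∀ r ∈ Set.Ioc s t, ∫⁻ ω in B, ENNReal.ofReal (g r (φ s ω + Y r ω)) ∂P ≤
      (K (-(d / p)) ∞ * P B) * (eLpNorm (g r) (ENNReal.ofReal p) volume *
        ENNReal.ofReal ((r - s) ^ (-(d / p * H)))) := by
    intro r hr
    refine (hN.setLIntegral_comp_add_le hd hp (hg.comp (Continuous.prodMk_right r)) (hg0 r) (hM r)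
      (hY.comp measurable_prodMk_left) hs hr.1 (hr.2.trans ht)
      (hφ.adapted s ⟨hs, hst.trans ht⟩) hB).trans_eq ?_
    rw [neg_mul]
    simp only [Function.comp_def, Function.uncurry_apply_pair]
    ring
  refine (setLIntegral_mono' measurableSet_Ioc h1).trans ?_
  rw [lintegral_const_mul _ (by fun_prop)]
  refine (mul_le_mul_right (setLIntegral_mul_rpow_le hq hc hmN hst) _).trans_eq ?_
  ring

/-- The constant of the smoothing bound for spatial increments. -/
def incrConst (d : ℕ) (K : ℝ → ℝ≥0∞ → ℝ≥0) (H p q θ : ℝ) : ℝ≥0∞ :=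
  K (-(d / p + θ)) ∞ * ENNReal.ofReal (4 * 2 ^ ((d : ℝ) / 2)) * timeConst q ((d / p + θ) * H)

/-- Refining a frozen integral at one intermediate time. -/
lemma frozen_integral_split_le (hN : NoiseAssumption P ℱ H κ K Y) (hd : 1 ≤ d) (hp : 1 ≤ p)
    (hq : 1 < q) (hθ0 : 0 ≤ θ) (hθ1 : θ ≤ 1) (hc : (d / p + θ) * H < 1 - 1 / q)
    (hY : Measurable (Function.uncurry Y))
    (hφ : ControlledPath P ℱ φ v) (hg : Continuous (Function.uncurry g))
    (hg0 : ∀ r y, 0 ≤ g r y) (hM : ∀ r y, ‖g r y‖ ≤ M)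
    (hs : 0 ≤ s) (hB : MeasurableSet[ℱ s] B) {a u b : ℝ} (hsa : s ≤ a) (hau : a ≤ u) (hub : u ≤ b)
    (hb : b ≤ 1) :
    (∫⁻ r in Set.Ioc a u, ∫⁻ ω in B, ENNReal.ofReal (g r (φ a ω + Y r ω)) ∂P) +
    (∫⁻ r in Set.Ioc u b, ∫⁻ ω in B, ENNReal.ofReal (g r (φ u ω + Y r ω)) ∂P) ≤
      (∫⁻ r in Set.Ioc a b, ∫⁻ ω in B, ENNReal.ofReal (g r (φ a ω + Y r ω)) ∂P) +
      incrConst d K H p q θ * P B ^ (1 - θ) *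
        ENNReal.ofReal ((b - u) ^ (1 - 1 / q - (d / p + θ) * H)) *
      ((∫⁻ r in Set.Ioc a b, eLpNorm (g r) (ENNReal.ofReal p) volume ^ q) ^ (1 / q) *
        (∫⁻ ω in B, accum v a b ω ∂P) ^ θ) := by
  have hmN : Measurable fun r => eLpNorm (g r) (ENNReal.ofReal p) volume :=
    measurable_eLpNorm_section hg.measurable (by linarith)
  have hm : ∀ a, Measurable fun r => ∫⁻ ω in B, ENNReal.ofReal (g r (φ a ω + Y r ω)) ∂P := by
    intro a
    refine measurable_uncurry_setLIntegral (F := fun r ω => ENNReal.ofReal (g r (φ a ω + Y r ω))) ?_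
    have h1 : Measurable fun z : ℝ × Ω => (z.1, φ a z.2 + Y z.1 z.2) :=
      measurable_fst.prodMk (((hφ.meas a).comp measurable_snd).add hY)
    exact (hg.measurable.comp h1).ennreal_ofReal
  -- On the left piece the freezing point does not change; only the right piece produces an error.
  rw [← setLIntegral_Ioc_add _ hau hub, add_assoc]
  refine add_le_add le_rfl ?_
  set D : ℝ≥0∞ := K (-(d / p + θ)) ∞ * ENNReal.ofReal (4 * 2 ^ ((d : ℝ) / 2)) with hD
  set I : ℝ≥0∞ := ∫⁻ ω in B, ‖φ u ω - φ a ω‖ₑ ^ θ ∂P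
  have h1 : ∀ r ∈ Set.Ioc u b, ∫⁻ ω in B, ENNReal.ofReal (g r (φ u ω + Y r ω)) ∂P ≤
      ∫⁻ ω in B, ENNReal.ofReal (g r (φ a ω + Y r ω)) ∂P +
      (D * I) * (eLpNorm (g r) (ENNReal.ofReal p) volume *
        ENNReal.ofReal ((r - u) ^ (-((d / p + θ) * H)))) := by
    intro r hr
    have ha := hφ.adapted a ⟨by linarith, by linarith⟩
    refine (hN.setLIntegral_comp_add_le_add hd hp hθ0 hθ1 (hg.comp (Continuous.prodMk_right r))
      (hg0 r) (hM r) (hY.comp measurable_prodMk_left) (by linarith) hr.1 (hr.2.trans hb)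
      (hφ.adapted u ⟨by linarith, by linarith⟩) (ha.mono (ℱ.mono hau))
      (ℱ.mono (hsa.trans hau) _ hB)).trans_eq ?_
    rw [neg_mul]
    simp only [Function.comp_def, Function.uncurry_apply_pair]
    ring
  refine (setLIntegral_mono' measurableSet_Ioc h1).trans ?_
  rw [lintegral_add_left (hm a), lintegral_const_mul _ (by fun_prop)]
  refine add_le_add le_rfl ?_
  -- The displacement of the path is bounded by the functional under estimation, which makes the
  -- final inequality self-referential. Jensen for the concave power `θ` brings out `P B ^ (1 - θ)`.
  have hI : I ≤ P B ^ (1 - θ) * (∫⁻ ω in B, accum v a b ω ∂P) ^ θ := by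
    have hmono : I ≤ ∫⁻ ω in B, (accum v a b ω) ^ θ ∂P := by
      refine lintegral_mono_ae (ae_restrict_of_ae ?_)
      filter_upwards [hφ.control] with ω hω
      refine ENNReal.rpow_le_rpow ((hω a u (by linarith) hau (by linarith)).trans ?_) hθ0
      exact accum_mono v le_rfl hub ω
    refine hmono.trans ((lintegral_rpow_le_of_le_one _
      (measurable_accum hφ.measv a b).aemeasurable hθ0 hθ1).trans_eq ?_)
    rw [Measure.restrict_apply_univ]
  refine (mul_le_mul' (mul_le_mul_right hI D) (setLIntegral_mul_rpow_le hq hc hmN hub)).trans ?_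
  have hNle : (∫⁻ r in Set.Ioc u b, eLpNorm (g r) (ENNReal.ofReal p) volume ^ q) ^ (1 / q) ≤
      (∫⁻ r in Set.Ioc a b, eLpNorm (g r) (ENNReal.ofReal p) volume ^ q) ^ (1 / q) :=
    ENNReal.rpow_le_rpow (lintegral_mono_set (Set.Ioc_subset_Ioc_left hau)) (by positivity)
  refine (mul_le_mul_right (mul_le_mul_left (mul_le_mul_right hNle _) _) _).trans_eq ?_
  rw [incrConst, ← hD]
  ring

/-- The dyadic points of `[s,t]`. -/
def dyadicPt (s t : ℝ) (n i : ℕ) : ℝ := s + i * ((t - s) / 2 ^ n)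

lemma dyadicPt_mono (hst : s ≤ t) (n : ℕ) : Monotone (dyadicPt s t n) := by
  intro i j hij
  unfold dyadicPt
  have : 0 ≤ (t - s) / 2 ^ n := div_nonneg (by linarith) (by positivity)
  have : (i : ℝ) ≤ j := by exact_mod_cast hij
  gcongr

@[simp] lemma dyadicPt_zero (s t : ℝ) (n : ℕ) : dyadicPt s t n 0 = s := by simp [dyadicPt]

@[simp] lemma dyadicPt_last (s t : ℝ) (n : ℕ) : dyadicPt s t n (2 ^ n) = t := by
  simp only [dyadicPt]; push_cast; field_simp; ring

lemma dyadicPt_succ_two_mul (s t : ℝ) (n i : ℕ) :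
    dyadicPt s t (n + 1) (2 * i) = dyadicPt s t n i := by
  simp only [dyadicPt, pow_succ]; push_cast; field_simp

lemma dyadicPt_succ_sub (s t : ℝ) (n i : ℕ) :
    dyadicPt s t n (i + 1) - dyadicPt s t n i = (t - s) / 2 ^ n := by
  simp only [dyadicPt]; push_cast; ring

/-- The integral with `φ` frozen at the left endpoints of the dyadic intervals of level `n`. -/
def dyadicSum (P : Measure Ω) (B : Set Ω) (g : ℝ → E d → ℝ) (φ Y : ℝ → Ω → E d) (s t : ℝ) (n : ℕ) :
    ℝ≥0∞ :=
  ∑ i ∈ Finset.range (2 ^ n), ∫⁻ r in Set.Ioc (dyadicPt s t n i) (dyadicPt s t n (i + 1)),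
    ∫⁻ ω in B, ENNReal.ofReal (g r (φ (dyadicPt s t n i) ω + Y r ω)) ∂P

/-- Each interval contributes `x i ^ (1/q) * y i ^ θ` times a power of its length, with `x` and `y`
additive. With `c = (d/p + θ) * H`, the `2^n` intervals cost `2^(n(1 - 1/q - θ))` in Hölder and the
lengths gain `2^(-n(1 - 1/q - c))`, so the net factor is `2^(-n(θ - c))`. -/
lemma dyadicSum_succ_le (hN : NoiseAssumption P ℱ H κ K Y) (hd : 1 ≤ d) (hp : 1 ≤ p)
    (hq : 1 < q) (hθ0 : 0 ≤ θ) (hθq : θ + 1 / q ≤ 1) (hc : (d / p + θ) * H < 1 - 1 / q)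
    (hY : Measurable (Function.uncurry Y))
    (hφ : ControlledPath P ℱ φ v) (hg : Continuous (Function.uncurry g))
    (hg0 : ∀ r y, 0 ≤ g r y) (hM : ∀ r y, ‖g r y‖ ≤ M)
    (hs : 0 ≤ s) (hst : s ≤ t) (ht : t ≤ 1) (hB : MeasurableSet[ℱ s] B) (n : ℕ) :
    dyadicSum P B g φ Y s t (n + 1) ≤ dyadicSum P B g φ Y s t n +
      incrConst d K H p q θ * P B ^ (1 - θ) *
      ((∫⁻ r in Set.Ioc s t, eLpNorm (g r) (ENNReal.ofReal p) volume ^ q) ^ (1 / q) *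
        (∫⁻ ω in B, accum v s t ω ∂P) ^ θ) *
        ENNReal.ofReal ((t - s) ^ (1 - 1 / q - (d / p + θ) * H)) *
        ENNReal.ofReal (2 ^ (-(θ - (d / p + θ) * H))) ^ n := by
  have hθ1 : θ ≤ 1 := by have : 0 ≤ 1 / q := by positivity
                         linarith
  set c := (d / p + θ) * H with hcdef
  set A := incrConst d K H p q θ * P B ^ (1 - θ)
  have hmon := dyadicPt_mono hst n
  have hmon' := dyadicPt_mono hst (n + 1)
  -- The refined intervals have level `n + 1`; the extra factor `1/2` is discarded.
  have hlen : ENNReal.ofReal (((t - s) / 2 ^ (n + 1)) ^ (1 - 1 / q - c)) ≤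
      ENNReal.ofReal ((t - s) ^ (1 - 1 / q - c)) * ENNReal.ofReal (2 ^ (-(1 - 1 / q - c))) ^ n := by
    rw [← ENNReal.ofReal_pow (by positivity),
      ← ENNReal.ofReal_mul (Real.rpow_nonneg (by linarith) _)]
    refine ENNReal.ofReal_le_ofReal ?_
    rw [← Real.rpow_mul_natCast (by norm_num), mul_comm _ (n : ℝ), Real.rpow_mul
      (by norm_num), Real.rpow_natCast, Real.rpow_neg (by positivity), ← div_eq_mul_inv,
      ← Real.div_rpow (by linarith) (by positivity)]
    refine Real.rpow_le_rpow (div_nonneg (by linarith) (by positivity)) ?_ (by linarith)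
    refine div_le_div_of_nonneg_left (by linarith) (by positivity) ?_
    exact pow_le_pow_right₀ (by norm_num) (Nat.le_succ n)
  set x : ℕ → ℝ≥0∞ := fun i => ∫⁻ r in Set.Ioc (dyadicPt s t n i) (dyadicPt s t n (i + 1)),
    eLpNorm (g r) (ENNReal.ofReal p) volume ^ q with hx
  set y : ℕ → ℝ≥0∞ := fun i => ∫⁻ ω in B,
    accum v (dyadicPt s t n i) (dyadicPt s t n (i + 1)) ω ∂P with hy
  have hsumx : ∑ i ∈ Finset.range (2 ^ n), x i =
      ∫⁻ r in Set.Ioc s t, eLpNorm (g r) (ENNReal.ofReal p) volume ^ q := by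
    rw [hx, sum_setLIntegral_Ioc _ hmon, dyadicPt_zero, dyadicPt_last]
  have hsumy : ∑ i ∈ Finset.range (2 ^ n), y i = ∫⁻ ω in B, accum v s t ω ∂P := by
    rw [hy, ← lintegral_finsetSum _ fun i _ => measurable_accum hφ.measv _ _]
    refine lintegral_congr fun ω => ?_
    unfold accum
    rw [sum_setLIntegral_Ioc _ hmon, dyadicPt_zero, dyadicPt_last]
  have hstep : ∀ i ∈ Finset.range (2 ^ n),
      (∫⁻ r in Set.Ioc (dyadicPt s t (n + 1) (2 * i)) (dyadicPt s t (n + 1) (2 * i + 1)),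
        ∫⁻ ω in B, ENNReal.ofReal (g r (φ (dyadicPt s t (n + 1) (2 * i)) ω + Y r ω)) ∂P) +
      (∫⁻ r in Set.Ioc (dyadicPt s t (n + 1) (2 * i + 1)) (dyadicPt s t (n + 1) (2 * i + 1 + 1)),
        ∫⁻ ω in B, ENNReal.ofReal (g r (φ (dyadicPt s t (n + 1) (2 * i + 1)) ω + Y r ω)) ∂P) ≤
      (∫⁻ r in Set.Ioc (dyadicPt s t n i) (dyadicPt s t n (i + 1)),
        ∫⁻ ω in B, ENNReal.ofReal (g r (φ (dyadicPt s t n i) ω + Y r ω)) ∂P) +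
      A * (ENNReal.ofReal ((t - s) ^ (1 - 1 / q - c)) *
        ENNReal.ofReal (2 ^ (-(1 - 1 / q - c))) ^ n) * (x i ^ (1 / q) * y i ^ θ) := by
    intro i hi
    have hi' : i + 1 ≤ 2 ^ n := Finset.mem_range.1 hi
    have e1 : dyadicPt s t (n + 1) (2 * i + 1 + 1) = dyadicPt s t n (i + 1) := by
      rw [← dyadicPt_succ_two_mul s t n (i + 1)]; congr 1
    have h1 : s ≤ dyadicPt s t n i := by simpa using hmon (Nat.zero_le i)
    have h2 : dyadicPt s t n (i + 1) ≤ 1 := by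
      refine le_trans ?_ ht
      simpa using hmon hi'
    have h3 : dyadicPt s t n i ≤ dyadicPt s t (n + 1) (2 * i + 1) := by
      rw [← dyadicPt_succ_two_mul]; exact hmon' (Nat.le_succ _)
    have h4 : dyadicPt s t (n + 1) (2 * i + 1) ≤ dyadicPt s t n (i + 1) := by
      rw [← e1]; exact hmon' (Nat.le_succ _)
    have h5 : dyadicPt s t n (i + 1) - dyadicPt s t (n + 1) (2 * i + 1) = (t - s) / 2 ^ (n + 1) := by
      rw [← e1, dyadicPt_succ_sub]
    have h := frozen_integral_split_le hN hd hp hq hθ0 hθ1 hc hY hφ hg hg0 hM hs hB h1 h3 h4 h2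
    rw [h5] at h
    rw [e1, dyadicPt_succ_two_mul]
    refine h.trans ?_
    gcongr
  unfold dyadicSum
  rw [pow_succ, mul_comm (2 ^ n) 2, sum_range_two_mul]
  refine (Finset.sum_le_sum hstep).trans ?_
  rw [Finset.sum_add_distrib, ← Finset.mul_sum]
  refine add_le_add le_rfl ?_
  refine (mul_le_mul_right (sum_rpow_mul_rpow_le x y (by positivity) hθ0 (by linarith) _) _).trans ?_
  rw [hsumx, hsumy]
  have hpow : ENNReal.ofReal (2 ^ (-(1 - 1 / q - c))) ^ n * ((2 ^ n : ℕ) : ℝ≥0∞) ^ (1 - 1 / q - θ) =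
      ENNReal.ofReal (2 ^ (-(θ - c))) ^ n := by
    have : ((2 ^ n : ℕ) : ℝ≥0∞) ^ (1 - 1 / q - θ) = ENNReal.ofReal (2 ^ (1 - 1 / q - θ)) ^ n := by
      rw [← ENNReal.ofReal_natCast, ENNReal.ofReal_rpow_of_nonneg (by positivity) (by linarith),
        ← ENNReal.ofReal_pow (by positivity)]
      congr 1
      push_cast
      rw [← Real.rpow_natCast, ← Real.rpow_natCast, ← Real.rpow_mul (by norm_num),
        ← Real.rpow_mul (by norm_num), mul_comm]
    rw [this, ← mul_pow, ← ENNReal.ofReal_mul (by positivity), ← Real.rpow_add (by norm_num)]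
    congr 3; ring
  rw [← hpow]
  refine le_of_eq ?_
  ring

/-- The constant of the sewing estimate. -/
def sewingConst (d : ℕ) (K : ℝ → ℝ≥0∞ → ℝ≥0) (H p q θ : ℝ) : ℝ≥0∞ :=
  K (-(d / p)) ∞ * timeConst q (d / p * H) +
    incrConst d K H p q θ * (1 - ENNReal.ofReal (2 ^ (-(θ - (d / p + θ) * H))))⁻¹

/-- The hypothesis is precisely that the geometric ratio of the refinement errors is below `1`. -/
lemma sewingConst_ne_top (hα : (d / p + θ) * H < θ) : sewingConst d K H p q θ ≠ ∞ := by
  have h2 : ENNReal.ofReal (2 ^ (-(θ - (d / p + θ) * H))) < 1 := by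
    rw [ENNReal.ofReal_lt_one]
    exact Real.rpow_lt_one_of_one_lt_of_neg (by norm_num) (by linarith)
  have h3 : (1 - ENNReal.ofReal (2 ^ (-(θ - (d / p + θ) * H))))⁻¹ ≠ ∞ := by
    rw [Ne, ENNReal.inv_eq_top, tsub_eq_zero_iff_le, not_le]
    exact h2
  have h4 : incrConst d K H p q θ ≠ ∞ := by
    unfold incrConst
    exact ENNReal.mul_ne_top (ENNReal.mul_ne_top ENNReal.coe_ne_top ENNReal.ofReal_ne_top)
      ENNReal.coe_ne_top
  exact ENNReal.add_ne_top.2 ⟨ENNReal.mul_ne_top ENNReal.coe_ne_top ENNReal.coe_ne_top,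
    ENNReal.mul_ne_top h4 h3⟩

/-- Refinement errors are added up from level `0`. The geometric series is summed in `ℝ≥0∞`, so no
condition on its ratio is required: a divergent series just makes the constant infinite. -/
lemma dyadicSum_le (hN : NoiseAssumption P ℱ H κ K Y) (hd : 1 ≤ d) (hp : 1 ≤ p)
    (hq : 1 < q) (hH : 0 ≤ H) (hθ0 : 0 ≤ θ) (hθq : θ + 1 / q ≤ 1)
    (hc : (d / p + θ) * H < 1 - 1 / q) (hY : Measurable (Function.uncurry Y))
    (hφ : ControlledPath P ℱ φ v) (hg : Continuous (Function.uncurry g))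
    (hg0 : ∀ r y, 0 ≤ g r y) (hM : ∀ r y, ‖g r y‖ ≤ M)
    (hs : 0 ≤ s) (hst : s ≤ t) (ht : t ≤ 1) (hB : MeasurableSet[ℱ s] B) (n : ℕ) :
    dyadicSum P B g φ Y s t n ≤ sewingConst d K H p q θ *
      (∫⁻ r in Set.Ioc s t, eLpNorm (g r) (ENNReal.ofReal p) volume ^ q) ^ (1 / q) *
      (ENNReal.ofReal ((t - s) ^ (1 - 1 / q - d / p * H)) * P B +
        ENNReal.ofReal ((t - s) ^ (1 - 1 / q - (d / p + θ) * H)) * P B ^ (1 - θ) *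
          (∫⁻ ω in B, accum v s t ω ∂P) ^ θ) := by
  set N := (∫⁻ r in Set.Ioc s t, eLpNorm (g r) (ENNReal.ofReal p) volume ^ q) ^ (1 / q)
  set y := ∫⁻ ω in B, accum v s t ω ∂P
  set ρ := ENNReal.ofReal (2 ^ (-(θ - (d / p + θ) * H))) with hρ
  set X := incrConst d K H p q θ * P B ^ (1 - θ) * (N * y ^ θ) *
    ENNReal.ofReal ((t - s) ^ (1 - 1 / q - (d / p + θ) * H)) with hX
  have hc0 : d / p * H < 1 - 1 / q := by nlinarith
  have hind : ∀ n, dyadicSum P B g φ Y s t n ≤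
      dyadicSum P B g φ Y s t 0 + X * ∑ k ∈ Finset.range n, ρ ^ k := by
    intro n
    induction n with
    | zero => simp
    | succ n ih =>
      refine (dyadicSum_succ_le hN hd hp hq hθ0 hθq hc hY hφ hg hg0 hM hs hst ht hB n).trans ?_
      rw [Finset.sum_range_succ, mul_add, ← add_assoc]
      exact add_le_add ih le_rfl
  have h0 : dyadicSum P B g φ Y s t 0 ≤ K (-(d / p)) ∞ * timeConst q (d / p * H) * N *
        (ENNReal.ofReal ((t - s) ^ (1 - 1 / q - d / p * H)) * P B) := by
    refine le_trans (le_of_eq ?_)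
      (frozen_integral_le hN hd hp hq hc0 hY hφ hg hg0 hM hs hst ht hB)
    simp [dyadicSum, dyadicPt]
  have hgeo : ∑ k ∈ Finset.range n, ρ ^ k ≤ (1 - ρ)⁻¹ := by
    rw [← ENNReal.tsum_geometric]
    exact ENNReal.sum_le_tsum _
  refine ((hind n).trans (add_le_add h0 (mul_le_mul_right hgeo X))).trans ?_
  rw [mul_add]
  refine add_le_add ?_ ?_
  · gcongr
    exact le_self_add
  · calc X * (1 - ρ)⁻¹ = incrConst d K H p q θ * (1 - ρ)⁻¹ * N *
          (ENNReal.ofReal ((t - s) ^ (1 - 1 / q - (d / p + θ) * H)) * P B ^ (1 - θ) * y ^ θ) := by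
          rw [hX]; ring
      _ ≤ _ := by
          gcongr
          exact le_add_self

end Sewing

/-! ### Removing the freezing by refining the partition. -/

section SewingLimit

variable {d : ℕ} {Ω : Type*} [mΩ : MeasurableSpace Ω] {P : Measure Ω}
  {ℱ : Filtration ℝ mΩ} {H : ℝ} {κ : ℝ≥0} {K : ℝ → ℝ≥0∞ → ℝ≥0} {Y φ : ℝ → Ω → E d}
  {v : ℝ → Ω → ℝ≥0∞} {p q θ M : ℝ} {g : ℝ → E d → ℝ} {B : Set Ω} {s t : ℝ}

/-- The left endpoint of the dyadic interval of level `n` that contains `r`. -/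
def dyadicLeft (s t : ℝ) (n : ℕ) (r : ℝ) : ℝ :=
  -- The intervals are open on the left and closed on the right, so the index is the ceiling minus
  -- one and not the floor.
  dyadicPt s t n (⌈(r - s) / ((t - s) / 2 ^ n)⌉₊ - 1)

lemma measurable_dyadicLeft (s t : ℝ) (n : ℕ) : Measurable (dyadicLeft s t n) := by
  unfold dyadicLeft
  have h1 : Measurable fun r : ℝ => ⌈(r - s) / ((t - s) / 2 ^ n)⌉₊ :=
    Nat.measurable_ceil.comp (by fun_prop)
  exact (measurable_of_countable fun k : ℕ => dyadicPt s t n (k - 1)).comp h1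

lemma dyadicLeft_eq (hst : s < t) {n i : ℕ} {r : ℝ}
    (hr : r ∈ Set.Ioc (dyadicPt s t n i) (dyadicPt s t n (i + 1))) :
    dyadicLeft s t n r = dyadicPt s t n i := by
  have hδ : 0 < (t - s) / 2 ^ n := div_pos (by linarith) (by positivity)
  have : ⌈(r - s) / ((t - s) / 2 ^ n)⌉₊ = i + 1 := by
    rw [Nat.ceil_eq_iff (by omega), lt_div_iff₀ hδ, div_le_iff₀ hδ]
    have h1 := hr.1
    have h2 := hr.2
    unfold dyadicPt at h1 h2
    constructor
    · rw [Nat.add_sub_cancel]; linarith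
    · linarith
  rw [dyadicLeft, this, Nat.add_sub_cancel]

lemma abs_dyadicLeft_sub_le (hst : s < t) {r : ℝ} (hr : s < r) (n : ℕ) :
    |dyadicLeft s t n r - r| ≤ (t - s) / 2 ^ n := by
  have hδ : 0 < (t - s) / 2 ^ n := div_pos (by linarith) (by positivity)
  have hx : 0 < (r - s) / ((t - s) / 2 ^ n) := div_pos (by linarith) hδ
  unfold dyadicLeft dyadicPt
  set δ := (t - s) / 2 ^ n
  have h1 := Nat.le_ceil ((r - s) / δ)
  have h2 := Nat.ceil_lt_add_one hx.le
  have h3 : 1 ≤ ⌈(r - s) / δ⌉₊ := Nat.ceil_pos.2 hx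
  rw [Nat.cast_sub h3]
  push_cast
  rw [div_le_iff₀ hδ] at h1
  rw [← sub_lt_iff_lt_add, lt_div_iff₀ hδ] at h2
  rw [abs_le]
  constructor <;> linarith

lemma tendsto_dyadicLeft (hst : s < t) {r : ℝ} (hr : s < r) :
    Filter.Tendsto (fun n => dyadicLeft s t n r) Filter.atTop (nhds r) := by
  rw [tendsto_iff_dist_tendsto_zero]
  refine squeeze_zero (fun _ => dist_nonneg) (fun n => abs_dyadicLeft_sub_le hst hr n) ?_
  have := (tendsto_pow_atTop_nhds_zero_of_lt_one (r := (1 / 2 : ℝ)) (by norm_num)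
    (by norm_num)).const_mul (t - s)
  simpa [div_eq_mul_inv] using this

lemma dyadicSum_eq (hst : s < t) (n : ℕ) :
    dyadicSum P B g φ Y s t n = ∫⁻ r in Set.Ioc s t, ∫⁻ ω in B,
      ENNReal.ofReal (g r (φ (dyadicLeft s t n r) ω + Y r ω)) ∂P := by
  have h := sum_setLIntegral_Ioc (fun r => ∫⁻ ω in B,
      ENNReal.ofReal (g r (φ (dyadicLeft s t n r) ω + Y r ω)) ∂P) (dyadicPt_mono hst.le n) (2 ^ n)
  rw [dyadicPt_zero, dyadicPt_last] at h
  rw [← h, dyadicSum]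
  refine Finset.sum_congr rfl fun i _ => setLIntegral_congr_fun measurableSet_Ioc fun r hr => ?_
  rw [dyadicLeft_eq hst hr]

variable [IsProbabilityMeasure P]

/-- The sewing estimate for continuous integrands. -/
lemma sewing_le_of_continuous (hN : NoiseAssumption P ℱ H κ K Y) (hd : 1 ≤ d) (hp : 1 ≤ p)
    (hq : 1 < q) (hH : 0 ≤ H) (hθ0 : 0 ≤ θ) (hθq : θ + 1 / q ≤ 1)
    (hc : (d / p + θ) * H < 1 - 1 / q) (hY : Measurable (Function.uncurry Y))
    (hφ : ControlledPath P ℱ φ v) (hg : Continuous (Function.uncurry g))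
    (hg0 : ∀ r y, 0 ≤ g r y) (hM : ∀ r y, ‖g r y‖ ≤ M)
    (hs : 0 ≤ s) (hst : s < t) (ht : t ≤ 1) (hB : MeasurableSet[ℱ s] B) :
    ∫⁻ r in Set.Ioc s t, ∫⁻ ω in B, ENNReal.ofReal (g r (φ r ω + Y r ω)) ∂P ≤
      sewingConst d K H p q θ *
      (∫⁻ r in Set.Ioc s t, eLpNorm (g r) (ENNReal.ofReal p) volume ^ q) ^ (1 / q) *
      (ENNReal.ofReal ((t - s) ^ (1 - 1 / q - d / p * H)) * P B +
        ENNReal.ofReal ((t - s) ^ (1 - 1 / q - (d / p + θ) * H)) * P B ^ (1 - θ) *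
          (∫⁻ ω in B, accum v s t ω ∂P) ^ θ) := by
  set R := sewingConst d K H p q θ *
      (∫⁻ r in Set.Ioc s t, eLpNorm (g r) (ENNReal.ofReal p) volume ^ q) ^ (1 / q) *
      (ENNReal.ofReal ((t - s) ^ (1 - 1 / q - d / p * H)) * P B +
        ENNReal.ofReal ((t - s) ^ (1 - 1 / q - (d / p + θ) * H)) * P B ^ (1 - θ) *
          (∫⁻ ω in B, accum v s t ω ∂P) ^ θ) with hR
  have hφm : Measurable (Function.uncurry φ) :=
    measurable_uncurry_of_continuous_of_measurable hφ.cont hφ.meas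
  set F : ℕ → ℝ → Ω → ℝ≥0∞ := fun n r ω =>
    ENNReal.ofReal (g r (φ (dyadicLeft s t n r) ω + Y r ω)) with hF
  have hFm : ∀ n, Measurable (Function.uncurry (F n)) := by
    intro n
    have h1 : Measurable fun z : ℝ × Ω => φ (dyadicLeft s t n z.1) z.2 :=
      hφm.comp (((measurable_dyadicLeft s t n).comp measurable_fst).prodMk measurable_snd)
    have h2 : Measurable fun z : ℝ × Ω => (z.1, φ (dyadicLeft s t n z.1) z.2 + Y z.1 z.2) :=
      measurable_fst.prodMk (h1.add hY)
    exact (hg.measurable.comp h2).ennreal_ofReal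
  have hlim : ∀ r ∈ Set.Ioc s t, ∀ ω, Filter.liminf (fun n => F n r ω) Filter.atTop =
      ENNReal.ofReal (g r (φ r ω + Y r ω)) := by
    intro r hr ω
    refine Filter.Tendsto.liminf_eq (ENNReal.tendsto_ofReal ?_)
    have h1 : Filter.Tendsto (fun n => φ (dyadicLeft s t n r) ω) Filter.atTop (nhds (φ r ω)) :=
      ((hφ.cont ω).tendsto r).comp (tendsto_dyadicLeft hst hr.1)
    have h2 : Continuous (g r) := hg.comp (Continuous.prodMk_right r)
    exact (h2.tendsto _).comp (h1.add_const (Y r ω))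
  -- Continuity of the path and of `g` gives pointwise convergence of the frozen integrands; since
  -- only an upper bound is wanted, Fatou in `ω` and then in `r` is enough.
  calc ∫⁻ r in Set.Ioc s t, ∫⁻ ω in B, ENNReal.ofReal (g r (φ r ω + Y r ω)) ∂P
      = ∫⁻ r in Set.Ioc s t, ∫⁻ ω in B, Filter.liminf (fun n => F n r ω) Filter.atTop ∂P :=
        setLIntegral_congr_fun measurableSet_Ioc fun r hr =>
          lintegral_congr fun ω => (hlim r hr ω).symm
    _ ≤ ∫⁻ r in Set.Ioc s t, Filter.liminf (fun n => ∫⁻ ω in B, F n r ω ∂P) Filter.atTop :=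
        lintegral_mono fun r => lintegral_liminf_le fun n => (hFm n).comp measurable_prodMk_left
    _ ≤ Filter.liminf (fun n => ∫⁻ r in Set.Ioc s t, ∫⁻ ω in B, F n r ω ∂P) Filter.atTop :=
        lintegral_liminf_le fun n => measurable_uncurry_setLIntegral (hFm n)
    _ ≤ R := by
        refine Filter.liminf_le_of_le (by isBoundedDefault) fun b hb => ?_
        obtain ⟨n, hn⟩ := hb.exists
        refine hn.trans ?_
        rw [← dyadicSum_eq hst]
        exact dyadicSum_le hN hd hp hq hH hθ0 hθq hc hY hφ hg hg0 hM hs hst.le ht hB n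

end SewingLimit

/-! ### From continuous to bounded measurable integrands. -/

section Extension

variable {d : ℕ}

/-- A continuous cutoff function, equal to `1` on the ball of radius `R` and to `0` off the ball of
radius `R + 1`. -/
def cutoff (R : ℝ) (y : E d) : ℝ := max 0 (min 1 (R + 1 - ‖y‖))

lemma continuous_cutoff (R : ℝ) : Continuous (cutoff R : E d → ℝ) := by
  unfold cutoff; fun_prop

lemma cutoff_nonneg (R : ℝ) (y : E d) : 0 ≤ cutoff R y := le_max_left _ _

lemma cutoff_le_one (R : ℝ) (y : E d) : cutoff R y ≤ 1 :=
  max_le zero_le_one (min_le_left _ _)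

lemma cutoff_eq_one {R : ℝ} {y : E d} (h : ‖y‖ ≤ R) : cutoff R y = 1 := by
  unfold cutoff
  rw [min_eq_left (by linarith), max_eq_right zero_le_one]

lemma cutoff_eq_zero {R : ℝ} {y : E d} (h : y ∉ Metric.ball (0 : E d) (R + 1)) :
    cutoff R y = 0 := by
  have h' : R + 1 ≤ ‖y‖ := by simpa using h
  unfold cutoff
  exact max_eq_left ((min_le_right _ _).trans (by linarith))

lemma eLpNorm_rpow_eq {p q : ℝ} (hp : 0 < p) (k : E d → ℝ) :
    eLpNorm k (ENNReal.ofReal p) volume ^ q = (∫⁻ y, ‖k y‖ₑ ^ p) ^ (q / p) := by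
  rw [eLpNorm_eq_lintegral_rpow_enorm_toReal (by simpa using hp) ENNReal.ofReal_ne_top,
    ENNReal.toReal_ofReal hp.le, ← ENNReal.rpow_mul]
  congr 1; ring

/-- Dominated convergence for the mixed norm. -/
lemma tendsto_mixed {p q M s t : ℝ} (hp : 0 < p) (hq : 0 < q) {S : Set (E d)}
    (hS : MeasurableSet S) (hSfin : volume S ≠ ∞) {g : ℕ → ℝ × E d → ℝ} {f : ℝ × E d → ℝ}
    (hgm : ∀ n, Measurable (g n)) (hgM : ∀ n z, ‖g n z‖ ≤ M)
    (hg0 : ∀ n (z : ℝ × E d), z.2 ∉ S → g n z = 0) (hf0 : ∀ z : ℝ × E d, z.2 ∉ S → f z = 0)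
    (hlim : ∀ᵐ z ∂((volume.restrict (Set.Ioc s t)).prod (volume.restrict S)),
      Filter.Tendsto (fun n => g n z) Filter.atTop (nhds (f z))) :
    Filter.Tendsto (fun n => (∫⁻ r in Set.Ioc s t,
      eLpNorm (fun y => g n (r, y)) (ENNReal.ofReal p) volume ^ q) ^ (1 / q)) Filter.atTop
      (nhds ((∫⁻ r in Set.Ioc s t,
        eLpNorm (fun y => f (r, y)) (ENNReal.ofReal p) volume ^ q) ^ (1 / q))) := by
  have hS' : ∀ k : E d → ℝ, (∀ y ∉ S, k y = 0) →
      ∫⁻ y, ‖k y‖ₑ ^ p = ∫⁻ y in S, ‖k y‖ₑ ^ p := by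
    intro k hk
    rw [← lintegral_indicator hS]
    refine lintegral_congr fun y => ?_
    by_cases hy : y ∈ S
    · simp [hy]
    · simp [hy, hk y hy, hp]
  have hbd : ∀ n z, ‖g n z‖ₑ ^ p ≤ ENNReal.ofReal M ^ p := by
    intro n z
    refine ENNReal.rpow_le_rpow ?_ hp.le
    rw [← ofReal_norm]
    exact ENNReal.ofReal_le_ofReal (hgM n z)
  have hC : ENNReal.ofReal M ^ p * volume S ≠ ∞ :=
    ENNReal.mul_ne_top (ENNReal.rpow_ne_top_of_nonneg hp.le ENNReal.ofReal_ne_top) hSfin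
  have hqp : 0 ≤ q / p := by positivity
  simp_rw [eLpNorm_rpow_eq hp]
  refine (ENNReal.continuous_rpow_const.tendsto _).comp ?_
  refine tendsto_lintegral_of_dominated_convergence
    (fun _ => (ENNReal.ofReal M ^ p * volume S) ^ (q / p)) (fun n => ?_) (fun n => ?_) ?_ ?_
  · have h : Measurable (Function.uncurry fun (r : ℝ) (y : E d) => ‖g n (r, y)‖ₑ ^ p) :=
      (hgm n).enorm.pow_const p
    exact h.lintegral_prod_right.pow_const _
  · refine ae_of_all _ fun r => ENNReal.rpow_le_rpow ?_ hqp
    rw [hS' _ fun y hy => hg0 n (r, y) hy]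
    exact (lintegral_mono fun y => hbd n (r, y)).trans_eq (setLIntegral_const _ _)
  · rw [setLIntegral_const]
    refine ENNReal.mul_ne_top (ENNReal.rpow_ne_top_of_nonneg hqp hC) ?_
    simp
  · filter_upwards [Measure.ae_ae_of_ae_prod hlim] with r hr
    refine (ENNReal.continuous_rpow_const.tendsto _).comp ?_
    rw [hS' _ fun y hy => hf0 (r, y) hy]
    simp_rw [fun n => hS' _ fun y hy => hg0 n (r, y) hy]
    refine tendsto_lintegral_of_dominated_convergence (fun _ => ENNReal.ofReal M ^ p)
      (fun n => ?_) (fun n => ae_of_all _ fun y => hbd n (r, y)) ?_ ?_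
    · exact ((hgm n).comp measurable_prodMk_left).enorm.pow_const p
    · rw [setLIntegral_const]; exact hC
    · filter_upwards [hr] with y hy
      exact (ENNReal.continuous_rpow_const.tendsto _).comp hy.enorm

lemma lintegral_le_of_tendsto {X : Type*} [MeasurableSpace X] {μ : Measure X} {F : ℕ → X → ℝ≥0∞}
    {f : X → ℝ≥0∞} (hF : ∀ n, Measurable (F n))
    (hlim : ∀ᵐ x ∂μ, Filter.Tendsto (fun n => F n x) Filter.atTop (nhds (f x)))
    {b : ℕ → ℝ≥0∞} {L : ℝ≥0∞} (hb : ∀ n, ∫⁻ x, F n x ∂μ ≤ b n)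
    (hbL : Filter.Tendsto b Filter.atTop (nhds L)) : ∫⁻ x, f x ∂μ ≤ L := by
  calc ∫⁻ x, f x ∂μ = ∫⁻ x, Filter.liminf (fun n => F n x) Filter.atTop ∂μ := by
        refine lintegral_congr_ae ?_
        filter_upwards [hlim] with x hx using hx.liminf_eq.symm
    _ ≤ Filter.liminf (fun n => ∫⁻ x, F n x ∂μ) Filter.atTop := lintegral_liminf_le hF
    _ ≤ Filter.liminf b Filter.atTop := Filter.liminf_le_liminf (Filter.Eventually.of_forall hb)
    _ = L := hbL.liminf_eq

/-- An estimate by the mixed norm extends from continuous to measurable bounded functions. -/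
lemma lintegral_le_mixed_of_continuous {p q M s t : ℝ} (hp : 0 < p) (hq : 0 < q)
    {μ : Measure (ℝ × E d)} [IsFiniteMeasure μ] {A : ℝ≥0∞} (hA : A ≠ ∞)
    (h : ∀ g : ℝ × E d → ℝ, Continuous g → (∀ z, 0 ≤ g z) → (∀ z, ‖g z‖ ≤ M) →
      ∫⁻ z, ENNReal.ofReal (g z) ∂μ ≤ A * (∫⁻ r in Set.Ioc s t,
        eLpNorm (fun y => g (r, y)) (ENNReal.ofReal p) volume ^ q) ^ (1 / q))
    {f : ℝ × E d → ℝ} (hf : Measurable f) (hf0 : ∀ z, 0 ≤ f z) (hfM : ∀ z, f z ≤ M) :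
    ∫⁻ z, ENNReal.ofReal (f z) ∂μ ≤ A * (∫⁻ r in Set.Ioc s t,
        eLpNorm (fun y => f (r, y)) (ENNReal.ofReal p) volume ^ q) ^ (1 / q) := by
  have hM0 : 0 ≤ M := (hf0 0).trans (hfM 0)
  have key : ∀ R : ℝ, ∫⁻ z, ENNReal.ofReal (f z * cutoff R z.2) ∂μ ≤ A * (∫⁻ r in Set.Ioc s t,
        eLpNorm (fun y => f (r, y)) (ENNReal.ofReal p) volume ^ q) ^ (1 / q) := by
    intro R
    set S : Set (E d) := Metric.ball 0 (R + 1)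
    have hSfin : volume S ≠ ∞ := measure_ball_lt_top.ne
    set ν₀ := (volume.restrict (Set.Ioc s t)).prod ((volume : Measure (E d)).restrict S)
    have : IsFiniteMeasure ((volume : Measure (E d)).restrict S) :=
      ⟨by rw [Measure.restrict_apply_univ]; exact hSfin.lt_top⟩
    -- `μ` need not be absolutely continuous. Approximating in `L_1` of the sum yields one sequence
    -- converging almost everywhere both for `μ`, as needed on the left, and for Lebesgue measure on
    -- the box, as needed on the right.
    set ν := μ + ν₀
    have hfL : MemLp f 1 ν := by
      refine MemLp.of_bound hf.aestronglyMeasurable M (ae_of_all _ fun z => ?_)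
      rw [Real.norm_of_nonneg (hf0 z)]
      exact hfM z
    have hex : ∀ n : ℕ, ∃ k : ℝ × E d → ℝ, Continuous k ∧
        eLpNorm (k - f) 1 ν ≤ ((n : ℝ≥0∞) + 1)⁻¹ := by
      intro n
      obtain ⟨k, -, hk, hkc, -⟩ := hfL.exists_hasCompactSupport_eLpNorm_sub_le ENNReal.one_ne_top
        (ε := ((n : ℝ≥0∞) + 1)⁻¹)
        (ENNReal.inv_ne_zero.2 (ENNReal.add_ne_top.2 ⟨ENNReal.natCast_ne_top n, ENNReal.one_ne_top⟩))
      exact ⟨k, hkc, by rwa [eLpNorm_sub_comm]⟩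
    choose k hkc hk using hex
    have hk0 : Filter.Tendsto (fun n => eLpNorm (k n - f) 1 ν) Filter.atTop (nhds 0) := by
      refine tendsto_of_tendsto_of_tendsto_of_le_of_le tendsto_const_nhds ?_ (fun _ => zero_le)
        hk
      have := (Filter.tendsto_add_atTop_iff_nat 1).2 ENNReal.tendsto_inv_nat_nhds_zero
      simpa using this
    obtain ⟨ns, -, hns⟩ := (tendstoInMeasure_of_tendsto_eLpNorm one_ne_zero
      (fun n => (hkc n).aestronglyMeasurable) hf.aestronglyMeasurable hk0).exists_seq_tendsto_ae
    -- Truncation to `[0, M]` keeps the approximants admissible and dominated; the cutoff confines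
    -- them to a set of finite volume.
    set g : ℕ → ℝ × E d → ℝ := fun n z => max 0 (min M (k (ns n) z)) * cutoff R z.2 with hg
    have hgc : ∀ n, Continuous (g n) := by
      intro n
      have h1 := hkc (ns n)
      have h2 : Continuous fun z : ℝ × E d => cutoff R z.2 :=
        (continuous_cutoff R).comp continuous_snd
      exact (continuous_const.max (continuous_const.min h1)).mul h2
    have hg0 : ∀ n z, 0 ≤ g n z := fun n z => mul_nonneg (le_max_left _ _) (cutoff_nonneg _ _)
    have hgM : ∀ n z, ‖g n z‖ ≤ M := by
      intro n z
      rw [Real.norm_of_nonneg (hg0 n z)]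
      exact (mul_le_of_le_one_right (le_max_left _ _) (cutoff_le_one _ _)).trans
        (max_le hM0 (min_le_left _ _))
    have hglim : ∀ᵐ z ∂ν, Filter.Tendsto (fun n => g n z) Filter.atTop
        (nhds (f z * cutoff R z.2)) := by
      filter_upwards [hns] with z hz
      refine Filter.Tendsto.mul_const _ ?_
      have h1 : f z = max 0 (min M (f z)) := by
        rw [min_eq_right (hfM z), max_eq_right (hf0 z)]
      rw [h1]
      exact tendsto_const_nhds.max (tendsto_const_nhds.min hz)
    rw [ae_add_measure_iff] at hglim
    have hmix := tendsto_mixed (s := s) (t := t) hp hq measurableSet_ball hSfin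
      (fun n => (hgc n).measurable) hgM
      (fun n z hz => by simp only [hg]; rw [cutoff_eq_zero hz, mul_zero])
      (f := fun z => f z * cutoff R z.2) (fun z hz => by rw [cutoff_eq_zero hz, mul_zero]) hglim.2
    refine (lintegral_le_of_tendsto (fun n => (hgc n).measurable.ennreal_ofReal)
      (hglim.1.mono fun z hz => ENNReal.tendsto_ofReal hz)
      (fun n => h (g n) (hgc n) (hg0 n) (hgM n))
      (ENNReal.Tendsto.const_mul hmix (Or.inr hA))).trans ?_
    refine mul_le_mul_right (ENNReal.rpow_le_rpow (lintegral_mono fun r => ?_) (by positivity)) _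
    refine ENNReal.rpow_le_rpow (eLpNorm_mono fun y => ?_) hq.le
    rw [norm_mul]
    refine mul_le_of_le_one_right (norm_nonneg _) ?_
    rw [Real.norm_of_nonneg (cutoff_nonneg _ _)]
    exact cutoff_le_one _ _
  -- The bound does not depend on the cutoff radius, so the cutoff is released by Fatou; at each
  -- point it is eventually equal to `1`.
  refine lintegral_le_of_tendsto (F := fun (n : ℕ) z => ENNReal.ofReal (f z * cutoff n z.2))
    (fun n => ?_) (ae_of_all _ fun z => ?_) (fun n => key n) tendsto_const_nhds
  · exact (hf.mul ((continuous_cutoff _).measurable.comp measurable_snd)).ennreal_ofReal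
  · refine tendsto_const_nhds.congr' ?_
    obtain ⟨n₀, hn₀⟩ := exists_nat_ge ‖z.2‖
    filter_upwards [Filter.eventually_ge_atTop n₀] with n hn
    have : (n₀ : ℝ) ≤ n := by exact_mod_cast hn
    rw [cutoff_eq_one (hn₀.trans this), mul_one]

end Extension

/-! ### The sewing estimate without continuity. -/

section SewingMeasurable

variable {d : ℕ} {Ω : Type*} [mΩ : MeasurableSpace Ω] {P : Measure Ω} [IsProbabilityMeasure P]
  {ℱ : Filtration ℝ mΩ} {H : ℝ} {κ : ℝ≥0} {K : ℝ → ℝ≥0∞ → ℝ≥0} {Y φ : ℝ → Ω → E d}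
  {v : ℝ → Ω → ℝ≥0∞} {p q θ M : ℝ} {B : Set Ω} {s t : ℝ}

/-- The sewing estimate for bounded measurable integrands. -/
lemma sewing_le (hN : NoiseAssumption P ℱ H κ K Y) (hd : 1 ≤ d) (hp : 1 ≤ p)
    (hq : 1 < q) (hH : 0 ≤ H) (hθ0 : 0 ≤ θ) (hθq : θ + 1 / q ≤ 1)
    (hc : (d / p + θ) * H < 1 - 1 / q) (hα : (d / p + θ) * H < θ)
    (hY : Measurable (Function.uncurry Y))
    (hφ : ControlledPath P ℱ φ v) (hs : 0 ≤ s) (hst : s < t) (ht : t ≤ 1)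
    (hB : MeasurableSet[ℱ s] B) (hfin : ∫⁻ ω in B, accum v s t ω ∂P ≠ ∞)
    {f : ℝ × E d → ℝ} (hf : Measurable f) (hf0 : ∀ z, 0 ≤ f z) (hfM : ∀ z, f z ≤ M) :
    ∫⁻ r in Set.Ioc s t, ∫⁻ ω in B, ENNReal.ofReal (f (r, φ r ω + Y r ω)) ∂P ≤
      sewingConst d K H p q θ *
      (ENNReal.ofReal ((t - s) ^ (1 - 1 / q - d / p * H)) * P B +
        ENNReal.ofReal ((t - s) ^ (1 - 1 / q - (d / p + θ) * H)) * P B ^ (1 - θ) *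
          (∫⁻ ω in B, accum v s t ω ∂P) ^ θ) *
      (∫⁻ r in Set.Ioc s t, eLpNorm (fun y => f (r, y)) (ENNReal.ofReal p) volume ^ q) ^ (1 / q) := by
  have hθ1 : θ ≤ 1 := by have : 0 ≤ 1 / q := by positivity
                         linarith
  have hφm : Measurable (Function.uncurry φ) :=
    measurable_uncurry_of_continuous_of_measurable hφ.cont hφ.meas
  set Ψ : ℝ × Ω → ℝ × E d := fun z => (z.1, φ z.1 z.2 + Y z.1 z.2)
  have hΨ : Measurable Ψ := measurable_fst.prodMk (hφm.add hY)
  -- The occupation measure of the space-time path on `B`. It turns the left-hand side into an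
  -- integral of `f` against a finite measure, to which the approximation lemma applies.
  set μ := ((volume.restrict (Set.Ioc s t)).prod (P.restrict B)).map Ψ
  have hμ : ∀ g : ℝ × E d → ℝ, Measurable g → ∫⁻ z, ENNReal.ofReal (g z) ∂μ =
      ∫⁻ r in Set.Ioc s t, ∫⁻ ω in B, ENNReal.ofReal (g (r, φ r ω + Y r ω)) ∂P := by
    intro g hg
    rw [lintegral_map hg.ennreal_ofReal hΨ]
    exact lintegral_prod _ (hg.ennreal_ofReal.comp hΨ).aemeasurable
  rw [← hμ f hf]
  refine lintegral_le_mixed_of_continuous (by linarith) (by linarith) ?_ (fun g hg hg0 hgM => ?_)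
    hf hf0 hfM
  · refine ENNReal.mul_ne_top (sewingConst_ne_top hα) (ENNReal.add_ne_top.2 ⟨?_, ?_⟩)
    · exact ENNReal.mul_ne_top ENNReal.ofReal_ne_top (measure_ne_top _ _)
    · refine ENNReal.mul_ne_top (ENNReal.mul_ne_top ENNReal.ofReal_ne_top ?_) ?_
      · exact ENNReal.rpow_ne_top_of_nonneg (by linarith) (measure_ne_top _ _)
      · exact ENNReal.rpow_ne_top_of_nonneg hθ0 hfin
  · rw [hμ g hg.measurable]
    refine (sewing_le_of_continuous (g := fun r y => g (r, y)) hN hd hp hq hH hθ0 hθq hc hY hφ hg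
      (fun r y => hg0 _) (fun r y => hgM _) hs hst ht hB).trans_eq ?_
    ring

end SewingMeasurable

/-! ### Absorbing the sublinear power. -/

section Absorption

/-- The larger of the two terms is at least half of the right-hand side. If it is the second one,
divide by `y ^ θ`; this is where finiteness of `y` matters. -/
lemma le_of_le_add_rpow {y P a b : ℝ≥0∞} {θ : ℝ} (hθ1 : θ < 1) (hy : y ≠ ∞)
    (h : y ≤ a * P + b * P ^ (1 - θ) * y ^ θ) :
    y ≤ (2 * a + (2 * b) ^ (1 / (1 - θ))) * P := by
  have h1θ : 0 < 1 - θ := by linarith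
  rw [add_mul]
  rcases le_total (b * P ^ (1 - θ) * y ^ θ) (a * P) with h1 | h1
  · refine le_add_right (h.trans ?_)
    calc a * P + b * P ^ (1 - θ) * y ^ θ ≤ a * P + a * P := by gcongr
      _ = _ := by ring
  · refine le_add_left ?_
    rcases eq_or_ne y 0 with rfl | hy0
    · exact zero_le
    have h2 : y ≤ 2 * b * P ^ (1 - θ) * y ^ θ := by
      calc y ≤ b * P ^ (1 - θ) * y ^ θ + b * P ^ (1 - θ) * y ^ θ :=
            h.trans (by gcongr)
        _ = _ := by ring
    have hyθ0 : y ^ θ ≠ 0 := by simp [hy0, hy]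
    have hyθt : y ^ θ ≠ ∞ := by simp [hy0, hy]
    have h3 : y ^ (1 - θ) ≤ 2 * b * P ^ (1 - θ) := by
      rw [ENNReal.rpow_sub _ _ hy0 hy, ENNReal.rpow_one]
      exact (ENNReal.div_le_iff hyθ0 hyθt).2 h2
    calc y = (y ^ (1 - θ)) ^ (1 / (1 - θ)) := by
          rw [← ENNReal.rpow_mul, mul_one_div_cancel h1θ.ne', ENNReal.rpow_one]
      _ ≤ (2 * b * P ^ (1 - θ)) ^ (1 / (1 - θ)) := ENNReal.rpow_le_rpow h3 (by positivity)
      _ = _ := by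
          rw [ENNReal.mul_rpow_of_nonneg _ _ (by positivity), ← ENNReal.rpow_mul,
            mul_one_div_cancel h1θ.ne', ENNReal.rpow_one]

/-- Used with `k = 1 / (1 - θ)`, to replace a power that depends on the auxiliary `θ` by the powers
`1` and `q`. -/
lemma rpow_le_add_rpow (G : ℝ≥0∞) {k q : ℝ} (hk : 1 ≤ k) (hkq : k ≤ q) : G ^ k ≤ G + G ^ q := by
  rcases le_total G 1 with h | h
  · refine le_add_right ?_
    simpa using ENNReal.rpow_le_rpow_of_exponent_ge h hk
  · exact le_add_left (ENNReal.rpow_le_rpow_of_exponent_le h hkq)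

end Absorption

/-! ### Khasminskii's lemma. -/

section Khasminskii

lemma setLIntegral_Ioc_swap {A w : ℝ → ℝ≥0∞} (hA : Measurable A) (hw : Measurable w) (s t : ℝ) :
    ∫⁻ r in Set.Ioc s t, A r * ∫⁻ r' in Set.Ioc s r, w r' =
      ∫⁻ r' in Set.Ioc s t, w r' * ∫⁻ r in Set.Ioc r' t, A r := by
  set S : Set (ℝ × ℝ) := {z | z.2 ≤ z.1}
  have hS : MeasurableSet S := measurableSet_le measurable_snd measurable_fst
  have h1 : ∀ r ∈ Set.Ioc s t, A r * ∫⁻ r' in Set.Ioc s r, w r' =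
      ∫⁻ r' in Set.Ioc s t, S.indicator (fun z => A z.1 * w z.2) (r, r') := by
    intro r hr
    rw [← lintegral_const_mul _ hw, ← lintegral_indicator measurableSet_Ioc,
      ← lintegral_indicator measurableSet_Ioc]
    refine lintegral_congr fun r' => ?_
    by_cases h1 : r' ≤ r <;> by_cases h2 : s < r' <;> by_cases h3 : r' ≤ t <;>
      simp [S, Set.indicator, h1, h2, h3]
    exact absurd (h1.trans hr.2) h3
  have h2 : ∀ r' ∈ Set.Ioc s t, w r' * ∫⁻ r in Set.Ioc r' t, A r =
      ∫⁻ r in Set.Ioc s t, S.indicator (fun z => A z.1 * w z.2) (r, r') := by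
    intro r' hr
    rw [setLIntegral_congr (μ := volume) (Ioc_ae_eq_Icc (a := r') (b := t)),
      ← lintegral_const_mul _ hA, ← lintegral_indicator measurableSet_Icc,
      ← lintegral_indicator measurableSet_Ioc]
    refine lintegral_congr fun r => ?_
    by_cases h1 : r' ≤ r <;> by_cases h2 : s < r <;> by_cases h3 : r ≤ t <;>
      simp [S, Set.indicator, h1, h2, h3, mul_comm]
    exact absurd (hr.1.trans_le h1) h2
  rw [setLIntegral_congr_fun measurableSet_Ioc h1, setLIntegral_congr_fun measurableSet_Ioc h2,
    lintegral_lintegral_swap]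
  refine Measurable.aemeasurable ?_
  exact ((hA.comp measurable_fst).mul (hw.comp measurable_snd)).indicator hS

/-- The chain rule for powers of an integral. -/
lemma pow_setLIntegral_Ioc {w : ℝ → ℝ≥0∞} (hw : Measurable w) (t : ℝ) (n : ℕ) : ∀ s : ℝ,
    (∫⁻ r in Set.Ioc s t, w r) ^ (n + 1) =
      (n + 1) * ∫⁻ r in Set.Ioc s t, w r * (∫⁻ r' in Set.Ioc r t, w r') ^ n := by
  have hW : Measurable fun r => ∫⁻ r' in Set.Ioc r t, w r' :=
    Antitone.measurable fun a b hab => lintegral_mono_set (Set.Ioc_subset_Ioc_left hab)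
  induction n with
  | zero => intro s; simp
  | succ n ih =>
    intro s
    set W : ℝ → ℝ≥0∞ := fun r => ∫⁻ r' in Set.Ioc r t, w r' with hWdef
    have hA : Measurable fun r => w r * W r ^ n := hw.mul (hW.pow_const n)
    have h1 : (∫⁻ r in Set.Ioc s t, w r * W r ^ n) * W s =
        (∫⁻ r in Set.Ioc s t, w r * W r ^ n * ∫⁻ r' in Set.Ioc s r, w r') +
        ∫⁻ r in Set.Ioc s t, w r * W r ^ (n + 1) := by
      rw [← lintegral_mul_const _ hA, ← lintegral_add_right _ (by fun_prop)]
      refine setLIntegral_congr_fun measurableSet_Ioc fun r hr => ?_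
      have h2 : W s = (∫⁻ r' in Set.Ioc s r, w r') + W r :=
        (setLIntegral_Ioc_add w hr.1.le hr.2).symm
      rw [h2, pow_succ]
      ring
    -- After exchanging the order of integration, the inner integral is `W ^ (n + 1)` up to the
    -- factor `n + 1`, by the induction hypothesis at the intermediate time.
    have h3 : ((n : ℝ≥0∞) + 1) * (∫⁻ r in Set.Ioc s t, w r * W r ^ n * ∫⁻ r' in Set.Ioc s r, w r') =
        ∫⁻ r in Set.Ioc s t, w r * W r ^ (n + 1) := by
      rw [setLIntegral_Ioc_swap hA hw,
        ← lintegral_const_mul' _ _ (ENNReal.add_ne_top.2 ⟨ENNReal.natCast_ne_top n, ENNReal.one_ne_top⟩)]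
      refine lintegral_congr fun r => ?_
      rw [mul_left_comm, ← ih r]
    rw [pow_succ, ih s, mul_assoc, h1, mul_add, h3]
    push_cast
    ring

/-- The hypothesis says that the conditional expectation of `X` given `m` is at most `c`. As an
inequality between measures on `m`, it can be integrated against any nonnegative `m`-measurable
function, with no integrability to check. -/
lemma setLIntegral_mul_le_of_forall {Ω : Type*} {m mΩ : MeasurableSpace Ω} {P : Measure Ω}
    (hm : m ≤ mΩ) {X φ : Ω → ℝ≥0∞} (hX : Measurable X) (hφ : AEStronglyMeasurable[m] φ P) {c : ℝ≥0∞}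
    (h : ∀ B : Set Ω, MeasurableSet[m] B → ∫⁻ ω in B, X ω ∂P ≤ c * P B) {B : Set Ω}
    (hB : MeasurableSet[m] B) : ∫⁻ ω in B, φ ω * X ω ∂P ≤ c * ∫⁻ ω in B, φ ω ∂P := by
  obtain ⟨φ', hφ', hφφ'⟩ := hφ
  set ψ : Ω → ℝ≥0∞ := B.indicator φ'
  have hψ : Measurable[m] ψ := hφ'.measurable.indicator hB
  have hle : (P.withDensity X).trim hm ≤ c • P.trim hm := by
    refine Measure.le_iff.2 fun S hS => ?_
    rw [trim_measurableSet_eq hm hS, Measure.smul_apply, trim_measurableSet_eq hm hS,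
      withDensity_apply _ (hm _ hS)]
    exact h S hS
  have h1 : ∫⁻ ω in B, φ ω * X ω ∂P = ∫⁻ ω, ψ ω ∂(P.withDensity X) := by
    rw [lintegral_withDensity_eq_lintegral_mul _ hX (hψ.mono hm le_rfl),
      ← lintegral_indicator (hm _ hB)]
    refine lintegral_congr_ae ?_
    filter_upwards [hφφ'] with ω hω
    by_cases hωB : ω ∈ B <;> simp [ψ, hωB, hω, mul_comm]
  have h2 : ∫⁻ ω in B, φ ω ∂P = ∫⁻ ω, ψ ω ∂P := by
    rw [← lintegral_indicator (hm _ hB)]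
    refine lintegral_congr_ae ?_
    filter_upwards [hφφ'] with ω hω
    by_cases hωB : ω ∈ B <;> simp [ψ, hωB, hω]
  rw [h1, h2, ← lintegral_trim hm hψ, ← lintegral_trim hm hψ, ← smul_eq_mul,
    ← lintegral_smul_measure]
  exact lintegral_mono' hle le_rfl

variable {Ω : Type*} {mΩ : MeasurableSpace Ω} {P : Measure Ω}

lemma measurable_uncurry_accum {v : ℝ → Ω → ℝ≥0∞} (hv : Measurable (Function.uncurry v)) (t : ℝ) :
    Measurable (Function.uncurry fun r ω => accum v r t ω) := by
  set S : Set ((ℝ × Ω) × ℝ) := {z | z.1.1 < z.2 ∧ z.2 ≤ t}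
  have hS : MeasurableSet S :=
    (measurableSet_lt (measurable_fst.comp measurable_fst) measurable_snd).inter
      (measurableSet_le measurable_snd measurable_const)
  have h1 : Measurable (S.indicator fun z => v z.2 z.1.2) :=
    Measurable.indicator (hv.comp (measurable_snd.prodMk (measurable_snd.comp measurable_fst))) hS
  have h2 : Measurable (Function.uncurry fun (a : ℝ × Ω) (b : ℝ) =>
    S.indicator (fun z => v z.2 z.1.2) (a, b)) := h1
  convert h2.lintegral_prod_right (ν := volume) using 1
  ext ⟨r, ω⟩
  simp only [Function.uncurry_apply_pair, accum]
  rw [← lintegral_indicator measurableSet_Ioc]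
  rfl

/-- **Khasminskii's lemma**: a bound on the conditional first moments of an increasing additive
functional yields bounds on all its moments. -/
lemma setLIntegral_accum_pow_le [IsProbabilityMeasure P] {ℱ : Filtration ℝ mΩ} {v : ℝ → Ω → ℝ≥0∞}
    (hv : Measurable (Function.uncurry v)) {s t : ℝ}
    (hva : ∀ r ∈ Set.Icc s t, AEStronglyMeasurable[ℱ r] (v r) P) {Γ : ℝ≥0∞}
    (hΓ : ∀ r ∈ Set.Icc s t, ∀ B : Set Ω, MeasurableSet[ℱ r] B →
      ∫⁻ ω in B, accum v r t ω ∂P ≤ Γ * P B) (n : ℕ) :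
    ∀ r ∈ Set.Icc s t, ∀ B : Set Ω, MeasurableSet[ℱ r] B →
      ∫⁻ ω in B, accum v r t ω ^ n ∂P ≤ n.factorial * Γ ^ n * P B := by
  induction n with
  | zero => intro r hr B hB; simp
  | succ n ih =>
    intro a ha B hB
    have hm := measurable_uncurry_accum hv t
    have hm2 : Measurable (Function.uncurry fun r ω => v r ω * accum v r t ω ^ n) :=
      hv.mul (hm.pow_const n)
    have h1 : ∫⁻ ω in B, accum v a t ω ^ (n + 1) ∂P =
        (n + 1) * ∫⁻ r in Set.Ioc a t, ∫⁻ ω in B, v r ω * accum v r t ω ^ n ∂P := by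
      rw [lintegral_lintegral_swap hm2.aemeasurable, ← lintegral_const_mul' _ _
        (ENNReal.add_ne_top.2 ⟨ENNReal.natCast_ne_top n, ENNReal.one_ne_top⟩)]
      refine lintegral_congr fun ω => ?_
      exact pow_setLIntegral_Ioc (hv.comp measurable_prodMk_right) t n a
    have h2 : ∫⁻ r in Set.Ioc a t, ∫⁻ ω in B, v r ω * accum v r t ω ^ n ∂P ≤
        n.factorial * Γ ^ n * ∫⁻ ω in B, accum v a t ω ∂P := by
      -- At time `r` the density `v r` is known, and the remaining factor depends on `(r,t]`, where
      -- the induction hypothesis bounds its conditional moment. What is left integrates to a first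
      -- moment.
      have h3 : ∀ r ∈ Set.Ioc a t, ∫⁻ ω in B, v r ω * accum v r t ω ^ n ∂P ≤
          n.factorial * Γ ^ n * ∫⁻ ω in B, v r ω ∂P := by
        intro r hr
        have hr' : r ∈ Set.Icc s t := ⟨ha.1.trans hr.1.le, hr.2⟩
        exact setLIntegral_mul_le_of_forall (ℱ.le r) ((measurable_accum hv r t).pow_const n)
          (hva r hr') (ih r hr') (ℱ.mono hr.1.le _ hB)
      refine (setLIntegral_mono' measurableSet_Ioc h3).trans_eq ?_
      rw [lintegral_const_mul _ (measurable_uncurry_setLIntegral hv),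
        lintegral_lintegral_swap hv.aemeasurable]
      rfl
    rw [h1]
    refine (mul_le_mul_right (h2.trans (mul_le_mul_right (hΓ a ha B hB) _)) _).trans_eq ?_
    rw [Nat.factorial_succ, pow_succ]
    push_cast
    ring

end Khasminskii

/-! ### Moments of the accumulated drift. -/

section Moments

variable {d : ℕ} {Ω : Type*} [mΩ : MeasurableSpace Ω] {P : Measure Ω} [IsProbabilityMeasure P]
  {ℱ : Filtration ℝ mΩ} {H : ℝ} {κ : ℝ≥0} {K : ℝ → ℝ≥0∞ → ℝ≥0} {Y φ : ℝ → Ω → E d}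
  {v : ℝ → Ω → ℝ≥0∞} {p q θ e M : ℝ} {B : Set Ω} {s t : ℝ} {f : ℝ × E d → ℝ}

/-- The mixed norm of a scalar function over `(s,t]`. -/
def scalarMixed (p q : ℝ) (f : ℝ × E d → ℝ) (s t : ℝ) : ℝ≥0∞ :=
  (∫⁻ r in Set.Ioc s t, eLpNorm (fun y => f (r, y)) (ENNReal.ofReal p) volume ^ q) ^ (1 / q)

lemma scalarMixed_mono (hq : 0 ≤ q) (f : ℝ × E d → ℝ) {s s' t t' : ℝ} (hs : s' ≤ s) (ht : t ≤ t') :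
    scalarMixed p q f s t ≤ scalarMixed p q f s' t' :=
  ENNReal.rpow_le_rpow (lintegral_mono_set (Set.Ioc_subset_Ioc hs ht)) (by positivity)

/-- The constant of the bound on conditional first moments. -/
def momentConst (d : ℕ) (K : ℝ → ℝ≥0∞ → ℝ≥0) (H p q θ : ℝ) : ℝ≥0∞ :=
  2 * sewingConst d K H p q θ + (2 * sewingConst d K H p q θ) ^ (1 / (1 - θ))

lemma momentConst_ne_top (hα : (d / p + θ) * H < θ) (hθ1 : θ < 1) :
    momentConst d K H p q θ ≠ ∞ := by
  have h := ENNReal.mul_ne_top ENNReal.ofNat_ne_top (sewingConst_ne_top (K := K) (q := q) hα) (a := 2)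
  refine ENNReal.add_ne_top.2 ⟨h, ENNReal.rpow_ne_top_of_nonneg ?_ h⟩
  have : 0 < 1 - θ := by linarith
  positivity

/-- The sewing estimate is applied with `v` equal to the integrand itself, so that `y` occurs on
both sides and can be absorbed. -/
lemma lintegral_accum_le (hN : NoiseAssumption P ℱ H κ K Y) (hd : 1 ≤ d) (hp : 1 ≤ p)
    (hq : 1 < q) (hH : 0 ≤ H) (hθ0 : 0 ≤ θ) (hθ1 : θ < 1) (hθq : θ + 1 / q ≤ 1)
    (hc : (d / p + θ) * H < 1 - 1 / q) (hα : (d / p + θ) * H < θ)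
    (he : e ≤ 1 - 1 / q - (d / p + θ) * H)
    (hY : Measurable (Function.uncurry Y)) (hf : Measurable f) (hf0 : ∀ z, 0 ≤ f z)
    (hfM : ∀ z, f z ≤ M)
    (hφ : ControlledPath P ℱ φ fun r ω => ENNReal.ofReal (f (r, φ r ω + Y r ω)))
    (hs : 0 ≤ s) (hst : s ≤ t) (ht : t ≤ 1) (hB : MeasurableSet[ℱ s] B) :
    ∫⁻ ω in B, accum (fun r ω => ENNReal.ofReal (f (r, φ r ω + Y r ω))) s t ω ∂P ≤
      momentConst d K H p q θ * (scalarMixed p q f s t + scalarMixed p q f s t ^ q) *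
        ENNReal.ofReal ((t - s) ^ e) * P B := by
  rcases hst.eq_or_lt with rfl | hst'
  · simp [accum]
  set v : ℝ → Ω → ℝ≥0∞ := fun r ω => ENNReal.ofReal (f (r, φ r ω + Y r ω)) with hv
  set y := ∫⁻ ω in B, accum v s t ω ∂P with hy
  set G := scalarMixed p q f s t with hG
  set D := sewingConst d K H p q θ with hD
  -- The bound `M` on `f` serves only qualitatively; it does not enter the constant.
  have hyfin : y ≠ ∞ := by
    have h1 : ∀ ω, accum v s t ω ≤ ENNReal.ofReal M * ENNReal.ofReal (t - s) := by
      intro ω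
      refine (lintegral_mono fun r => ENNReal.ofReal_le_ofReal (hfM _)).trans_eq ?_
      rw [setLIntegral_const, Real.volume_Ioc]
    refine ne_top_of_le_ne_top ?_ (lintegral_mono h1)
    rw [setLIntegral_const]
    exact ENNReal.mul_ne_top (ENNReal.mul_ne_top ENNReal.ofReal_ne_top ENNReal.ofReal_ne_top)
      (measure_ne_top _ _)
  have hsw := sewing_le hN hd hp hq hH hθ0 hθq hc hα hY hφ hs hst' ht hB hyfin hf hf0 hfM
  have hsw' : y ≤ (D * G * ENNReal.ofReal ((t - s) ^ (1 - 1 / q - d / p * H))) * P B +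
      (D * G * ENNReal.ofReal ((t - s) ^ (1 - 1 / q - (d / p + θ) * H))) * P B ^ (1 - θ) *
        y ^ θ := by
    have hswap : y = ∫⁻ r in Set.Ioc s t, ∫⁻ ω in B, v r ω ∂P := by
      rw [hy, lintegral_lintegral_swap hφ.measv.aemeasurable]
      rfl
    calc y = _ := hswap
      _ ≤ _ := hsw
      _ = _ := by rw [hG, scalarMixed]; ring
  refine (le_of_le_add_rpow hθ1 hyfin hsw').trans ?_
  refine mul_le_mul_left ?_ _
  have hτ0 : 0 < t - s := by linarith
  have hτ1 : t - s ≤ 1 := by linarith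
  set T := ENNReal.ofReal ((t - s) ^ e)
  have hT0 : ENNReal.ofReal ((t - s) ^ (1 - 1 / q - d / p * H)) ≤ T := by
    refine ENNReal.ofReal_le_ofReal (Real.rpow_le_rpow_of_exponent_ge hτ0 hτ1 ?_)
    nlinarith
  have h1θ : 0 < 1 - θ := by linarith
  have hk1 : 1 ≤ 1 / (1 - θ) := by rw [le_div_iff₀ h1θ]; linarith
  -- Equivalent to `θ ≤ 1 - 1/q`.
  have hkq : 1 / (1 - θ) ≤ q := by
    rw [div_le_iff₀ h1θ]
    have : q * (1 / q) ≤ q * (1 - θ) := by gcongr; linarith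
    rwa [mul_one_div_cancel (by linarith)] at this
  set k := 1 / (1 - θ)
  have hT1 : ENNReal.ofReal ((t - s) ^ (1 - 1 / q - (d / p + θ) * H)) ^ k ≤ T := by
    rw [ENNReal.ofReal_rpow_of_nonneg (by positivity) (by positivity), ← Real.rpow_mul hτ0.le]
    refine ENNReal.ofReal_le_ofReal (Real.rpow_le_rpow_of_exponent_ge hτ0 hτ1 ?_)
    nlinarith
  have hGk := rpow_le_add_rpow G hk1 hkq
  have hk0 : 0 ≤ k := by linarith
  calc 2 * (D * G * ENNReal.ofReal ((t - s) ^ (1 - 1 / q - d / p * H))) +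
        (2 * (D * G * ENNReal.ofReal ((t - s) ^ (1 - 1 / q - (d / p + θ) * H)))) ^ k
      = 2 * D * G * ENNReal.ofReal ((t - s) ^ (1 - 1 / q - d / p * H)) +
        (2 * D) ^ k * G ^ k * ENNReal.ofReal ((t - s) ^ (1 - 1 / q - (d / p + θ) * H)) ^ k := by
        rw [← ENNReal.mul_rpow_of_nonneg _ _ hk0, ← ENNReal.mul_rpow_of_nonneg _ _ hk0]
        congr 1
        · ring
        · congr 1; ring
    _ ≤ 2 * D * (G + G ^ q) * T + (2 * D) ^ k * (G + G ^ q) * T := by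
        gcongr
        exact le_self_add
    _ = _ := by rw [momentConst]; ring

/-- Khasminskii requires one constant for all intermediate starting times `r`. The first-moment
bound on `[r,t]` is at most that on `[s,t]`, because the mixed norm is monotone and `e ≥ 0`. -/
lemma lintegral_accum_pow_le (hN : NoiseAssumption P ℱ H κ K Y) (hd : 1 ≤ d) (hp : 1 ≤ p)
    (hq : 1 < q) (hH : 0 ≤ H) (hθ0 : 0 ≤ θ) (hθ1 : θ < 1) (hθq : θ + 1 / q ≤ 1)
    (hc : (d / p + θ) * H < 1 - 1 / q) (hα : (d / p + θ) * H < θ)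
    (he0 : 0 ≤ e) (he : e ≤ 1 - 1 / q - (d / p + θ) * H)
    (hY : Measurable (Function.uncurry Y)) (hYa : ∀ r ∈ Set.Icc (0 : ℝ) 1, Measurable[ℱ r] (Y r))
    (hf : Measurable f) (hf0 : ∀ z, 0 ≤ f z) (hfM : ∀ z, f z ≤ M)
    (hφ : ControlledPath P ℱ φ fun r ω => ENNReal.ofReal (f (r, φ r ω + Y r ω)))
    (hs : 0 ≤ s) (hst : s ≤ t) (ht : t ≤ 1) (n : ℕ) :
    ∫⁻ ω, accum (fun r ω => ENNReal.ofReal (f (r, φ r ω + Y r ω))) s t ω ^ n ∂P ≤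
      n.factorial * (momentConst d K H p q θ *
        (scalarMixed p q f s t + scalarMixed p q f s t ^ q) * ENNReal.ofReal ((t - s) ^ e)) ^ n := by
  have h := setLIntegral_accum_pow_le (P := P) (ℱ := ℱ) hφ.measv (s := s) (t := t)
    (Γ := momentConst d K H p q θ * (scalarMixed p q f s t + scalarMixed p q f s t ^ q) * ENNReal.ofReal ((t - s) ^ e))
    (fun r hr => ?_) (fun r hr B hB => ?_) n s ⟨le_rfl, hst⟩ Set.univ MeasurableSet.univ
  · simpa using h
  · have hr' : r ∈ Set.Icc (0 : ℝ) 1 := ⟨hs.trans hr.1, hr.2.trans ht⟩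
    obtain ⟨φ', hφ', hφφ'⟩ := hφ.adapted r hr'
    have h1 : Measurable fun z : E d => ENNReal.ofReal (f (r, z)) :=
      (hf.comp measurable_prodMk_left).ennreal_ofReal
    have h2 : Measurable[ℱ r] fun ω => φ' ω + Y r ω := hφ'.measurable.add (hYa r hr')
    refine ⟨fun ω => ENNReal.ofReal (f (r, φ' ω + Y r ω)), (h1.comp h2).stronglyMeasurable, ?_⟩
    filter_upwards [hφφ'] with ω hω
    rw [hω]
  · refine (lintegral_accum_le hN hd hp hq hH hθ0 hθ1 hθq hc hα he hY hf hf0 hfM hφ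
      (hs.trans hr.1) hr.2 ht hB).trans ?_
    have hm := scalarMixed_mono (p := p) (by linarith : 0 ≤ q) f hr.1 (le_refl t)
    have : (t - r) ^ e ≤ (t - s) ^ e :=
      Real.rpow_le_rpow (by linarith [hr.2]) (by linarith [hr.1]) he0
    gcongr

end Moments

/-! ### Hölder regularity from moments over dyadic intervals. -/

section Holder

variable {Ω : Type*} {v : ℝ → Ω → ℝ≥0∞}

/-- A random variable that dominates the `n`-th power of the Hölder seminorm of exponent `γ`. -/
def dyadicSup (v : ℝ → Ω → ℝ≥0∞) (γ : ℝ) (n : ℕ) (ω : Ω) : ℝ≥0∞ :=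
  ∑' k : ℕ, ∑ i ∈ Finset.range (2 ^ k),
    (ENNReal.ofReal (2 ^ γ) ^ k * accum v (dyadicPt 0 1 k i) (dyadicPt 0 1 k (i + 1)) ω) ^ n

lemma accum_dyadic_le {γ : ℝ} {n k i : ℕ} (hn : n ≠ 0) (hi : i < 2 ^ k) (ω : Ω) :
    ENNReal.ofReal (2 ^ γ) ^ k * accum v (dyadicPt 0 1 k i) (dyadicPt 0 1 k (i + 1)) ω ≤
      dyadicSup v γ n ω ^ (1 / (n : ℝ)) := by
  set x := ENNReal.ofReal (2 ^ γ) ^ k * accum v (dyadicPt 0 1 k i) (dyadicPt 0 1 k (i + 1)) ω with hx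
  have h : x ^ n ≤ dyadicSup v γ n ω := by
    refine le_trans ?_ (ENNReal.le_tsum k)
    exact Finset.single_le_sum (f := fun i => (ENNReal.ofReal (2 ^ γ) ^ k *
      accum v (dyadicPt 0 1 k i) (dyadicPt 0 1 k (i + 1)) ω) ^ n) (fun _ _ => zero_le)
      (Finset.mem_range.2 hi)
  have hn' : (n : ℝ) ≠ 0 := by exact_mod_cast hn
  calc x = (x ^ n) ^ (1 / (n : ℝ)) := by
        rw [← ENNReal.rpow_natCast, ← ENNReal.rpow_mul, mul_one_div_cancel hn', ENNReal.rpow_one]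
    _ ≤ _ := ENNReal.rpow_le_rpow h (by positivity)

lemma accum_add (v : ℝ → Ω → ℝ≥0∞) {a b c : ℝ} (hab : a ≤ b) (hbc : b ≤ c) (ω : Ω) :
    accum v a c ω = accum v a b ω + accum v b c ω :=
  (setLIntegral_Ioc_add _ hab hbc).symm

/-- An interval of length between `2^(-k-1)` and `2^(-k)` is covered by two neighbouring dyadic
intervals of level `k`. Monotonicity and additivity of `accum` make chaining over levels
superfluous. The `4` comes from the two intervals and `2 ^ γ ≤ 2`. -/
lemma accum_div_le {γ : ℝ} (hγ0 : 0 ≤ γ) (hγ1 : γ ≤ 1) {n : ℕ} (hn : n ≠ 0) {s t : ℝ} (hs : 0 ≤ s)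
    (hst : s < t) (ht : t ≤ 1) (ω : Ω) :
    accum v s t ω / ENNReal.ofReal ((t - s) ^ γ) ≤ 4 * dyadicSup v γ n ω ^ (1 / (n : ℝ)) := by
  obtain ⟨k, hk1, hk2⟩ := exists_nat_pow_near_of_lt_one (x := t - s) (y := (1 / 2 : ℝ))
    (by linarith) (by linarith) (by norm_num) (by norm_num)
  set X := dyadicSup v γ n ω ^ (1 / (n : ℝ))
  set b := ENNReal.ofReal (2 ^ γ) with hb
  have h2k : (0 : ℝ) < 2 ^ k := by positivity
  have hpt : ∀ i : ℕ, dyadicPt 0 1 k i = i / 2 ^ k := by intro i; simp [dyadicPt, div_eq_mul_inv]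
  set i := ⌊s * 2 ^ k⌋₊
  have hi1 : (i : ℝ) ≤ s * 2 ^ k := Nat.floor_le (by positivity)
  have hi2 : s * 2 ^ k < i + 1 := Nat.lt_floor_add_one _
  have ht2 : t * 2 ^ k ≤ i + 2 := by
    have : (t - s) * 2 ^ k ≤ 1 := by
      calc (t - s) * 2 ^ k ≤ (1 / 2) ^ k * 2 ^ k := by gcongr
        _ = 1 := by rw [← mul_pow]; norm_num
    linarith
  have hi : i < 2 ^ k := by
    have : (i : ℝ) < 2 ^ k := hi1.trans_lt (by nlinarith)
    exact_mod_cast this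
  have hsi : dyadicPt 0 1 k i ≤ s := by rw [hpt, div_le_iff₀ h2k]; exact hi1
  have hsi' : s ≤ dyadicPt 0 1 k (i + 1) := by
    rw [hpt, le_div_iff₀ h2k]; push_cast; exact hi2.le
  have hti : t ≤ dyadicPt 0 1 k (i + 2) := by
    rw [hpt, le_div_iff₀ h2k]; push_cast; exact ht2
  have hcov : b ^ k * accum v s t ω ≤ 2 * X := by
    rcases le_total t (dyadicPt 0 1 k (i + 1)) with h | h
    · calc b ^ k * accum v s t ω
          ≤ b ^ k * accum v (dyadicPt 0 1 k i) (dyadicPt 0 1 k (i + 1)) ω := by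
            gcongr; exact accum_mono v hsi h ω
        _ ≤ X := accum_dyadic_le hn hi ω
        _ ≤ 2 * X := by rw [two_mul]; exact le_self_add
    -- If `t` equals the dyadic point, the next interval may stick out of `[0,1]`; strict inequality
    -- guarantees that it does not.
    · rcases h.eq_or_lt with h' | h'
      · calc b ^ k * accum v s t ω
            ≤ b ^ k * accum v (dyadicPt 0 1 k i) (dyadicPt 0 1 k (i + 1)) ω := by
              gcongr; exact accum_mono v hsi h'.ge ω
          _ ≤ X := accum_dyadic_le hn hi ω
          _ ≤ 2 * X := by rw [two_mul]; exact le_self_add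
      have hi' : i + 1 < 2 ^ k := by
        rw [hpt, div_lt_iff₀ h2k] at h'
        have : ((i + 1 : ℕ) : ℝ) < 2 ^ k := h'.trans_le (by nlinarith)
        exact_mod_cast this
      calc b ^ k * accum v s t ω
          = b ^ k * accum v s (dyadicPt 0 1 k (i + 1)) ω +
            b ^ k * accum v (dyadicPt 0 1 k (i + 1)) t ω := by
            rw [accum_add v hsi' h, mul_add]
        _ ≤ b ^ k * accum v (dyadicPt 0 1 k i) (dyadicPt 0 1 k (i + 1)) ω +
            b ^ k * accum v (dyadicPt 0 1 k (i + 1)) (dyadicPt 0 1 k (i + 1 + 1)) ω := by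
            gcongr
            · exact accum_mono v hsi le_rfl ω
            · exact accum_mono v le_rfl hti ω
        _ ≤ X + X := add_le_add (accum_dyadic_le hn hi ω) (accum_dyadic_le hn hi' ω)
        _ = 2 * X := (two_mul X).symm
  have hts : 0 < t - s := by linarith
  have hone : 1 ≤ b * b ^ k * ENNReal.ofReal ((t - s) ^ γ) := by
    rw [← pow_succ', hb, ← ENNReal.ofReal_pow (by positivity), ← ENNReal.ofReal_mul (by positivity),
      ← Real.rpow_natCast, ← Real.rpow_mul (by norm_num), mul_comm γ, Real.rpow_mul (by norm_num),
      Real.rpow_natCast, ← Real.mul_rpow (by positivity) hts.le, ENNReal.one_le_ofReal]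
    refine Real.one_le_rpow ?_ hγ0
    calc (1 : ℝ) = 2 ^ (k + 1) * (1 / 2) ^ (k + 1) := by rw [← mul_pow]; norm_num
      _ ≤ _ := by gcongr
  have hb2 : b ≤ 2 := by
    rw [hb, show (2 : ℝ≥0∞) = ENNReal.ofReal 2 by simp]
    refine ENNReal.ofReal_le_ofReal ?_
    simpa using Real.rpow_le_rpow_of_exponent_le (by norm_num : (1 : ℝ) ≤ 2) hγ1
  refine ENNReal.div_le_of_le_mul ?_
  calc accum v s t ω ≤ accum v s t ω * (b * b ^ k * ENNReal.ofReal ((t - s) ^ γ)) :=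
        le_mul_of_one_le_right zero_le hone
    _ = b * (b ^ k * accum v s t ω) * ENNReal.ofReal ((t - s) ^ γ) := by ring
    _ ≤ 2 * (2 * X) * ENNReal.ofReal ((t - s) ^ γ) := by gcongr
    _ = 4 * X * ENNReal.ofReal ((t - s) ^ γ) := by ring

variable [MeasurableSpace Ω] {P : Measure Ω}

lemma measurable_dyadicSup (hv : Measurable (Function.uncurry v)) (γ : ℝ) (n : ℕ) :
    Measurable (dyadicSup v γ n) :=
  Measurable.tsum fun _ => Finset.measurable_sum _ fun _ _ =>
    ((measurable_accum hv _ _).const_mul _).pow_const n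

/-- Level `k` has `2^k` terms of size `A * 2^(k n (γ - e))`, so the levels form a geometric series
of ratio `2^(1 + n(γ - e))`. -/
lemma lintegral_dyadicSup_le (hv : Measurable (Function.uncurry v)) {γ e : ℝ} {n : ℕ} {A : ℝ≥0∞}
    (hmom : ∀ s t : ℝ, 0 ≤ s → s ≤ t → t ≤ 1 →
      ∫⁻ ω, accum v s t ω ^ n ∂P ≤ A * ENNReal.ofReal ((t - s) ^ e) ^ n) :
    ∫⁻ ω, dyadicSup v γ n ω ∂P ≤ A * (1 - ENNReal.ofReal (2 ^ (1 + n * (γ - e))))⁻¹ := by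
  unfold dyadicSup
  rw [lintegral_tsum fun k => (Finset.measurable_sum _ fun i _ =>
    ((measurable_accum hv _ _).const_mul _).pow_const n).aemeasurable,
    ← ENNReal.tsum_geometric, ← ENNReal.tsum_mul_left]
  refine ENNReal.tsum_le_tsum fun k => ?_
  rw [lintegral_finsetSum _ fun i _ => ((measurable_accum hv _ _).const_mul _).pow_const n]
  have hi : ∀ i ∈ Finset.range (2 ^ k), ∫⁻ ω, (ENNReal.ofReal (2 ^ γ) ^ k *
      accum v (dyadicPt 0 1 k i) (dyadicPt 0 1 k (i + 1)) ω) ^ n ∂P ≤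
      (ENNReal.ofReal (2 ^ γ) ^ k) ^ n * (A * ENNReal.ofReal (((1 - 0) / 2 ^ k) ^ e) ^ n) := by
    intro i hi
    simp_rw [mul_pow]
    rw [lintegral_const_mul _ ((measurable_accum hv _ _).pow_const n), ← dyadicPt_succ_sub 0 1 k i]
    have hmon := dyadicPt_mono (zero_le_one (α := ℝ)) k
    gcongr
    refine hmom _ _ ?_ (hmon (Nat.le_succ i)) ?_
    · simpa using hmon (Nat.zero_le i)
    · simpa using hmon (Nat.succ_le_of_lt (Finset.mem_range.1 hi))
  refine (Finset.sum_le_sum hi).trans_eq ?_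
  rw [Finset.sum_const, Finset.card_range, nsmul_eq_mul]
  have h1 : ENNReal.ofReal (((1 - 0) / 2 ^ k) ^ e) = ENNReal.ofReal (2 ^ (-e)) ^ k := by
    rw [← ENNReal.ofReal_pow (by positivity)]
    congr 1
    rw [← Real.rpow_natCast, ← Real.rpow_natCast, ← Real.rpow_mul (by norm_num), sub_zero, one_div,
      ← Real.rpow_neg (by norm_num), ← Real.rpow_mul (by norm_num)]
    congr 1; ring
  have h2 : ENNReal.ofReal (2 ^ (1 + n * (γ - e))) =
      2 * ENNReal.ofReal (2 ^ γ) ^ n * ENNReal.ofReal (2 ^ (-e)) ^ n := by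
    rw [← ENNReal.ofReal_pow (by positivity), ← ENNReal.ofReal_pow (by positivity),
      show (2 : ℝ≥0∞) = ENNReal.ofReal 2 by simp, ← ENNReal.ofReal_mul (by positivity),
      ← ENNReal.ofReal_mul (by positivity), ← Real.rpow_natCast, ← Real.rpow_natCast,
      ← Real.rpow_mul (by norm_num), ← Real.rpow_mul (by norm_num), Real.rpow_add (by norm_num),
      Real.rpow_one, mul_assoc, ← Real.rpow_add (by norm_num)]
    congr 3; ring
  rw [h1, h2]
  push_cast
  simp_rw [mul_pow, ← pow_mul]
  rw [mul_comm n k]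
  ring

end Holder

/-! ### Solutions as controlled paths. -/

section Solution

variable {d : ℕ}

/-- The norm of the drift along the space variable shifted by `x`, set to zero off the time
interval `[0,1]`. -/
def driftNorm (x : E d) (f : ℝ → E d → E d) (z : ℝ × E d) : ℝ :=
  (Set.Icc (0 : ℝ) 1).indicator (fun r => ‖f r (x + z.2)‖) z.1

lemma driftNorm_of_mem {x : E d} {f : ℝ → E d → E d} {r : ℝ} (hr : r ∈ Set.Icc (0 : ℝ) 1)
    (y : E d) : driftNorm x f (r, y) = ‖f r (x + y)‖ :=
  Set.indicator_of_mem hr _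

lemma driftNorm_nonneg (x : E d) (f : ℝ → E d → E d) (z : ℝ × E d) : 0 ≤ driftNorm x f z :=
  Set.indicator_nonneg (fun _ _ => norm_nonneg _) _

lemma driftNorm_le {x : E d} {f : ℝ → E d → E d} {M : ℝ}
    (hM : ∀ r ∈ Set.Icc (0 : ℝ) 1, ∀ y, ‖f r y‖ ≤ M) (z : ℝ × E d) : driftNorm x f z ≤ M := by
  have hM0 : 0 ≤ M := (norm_nonneg _).trans (hM 0 ⟨le_rfl, zero_le_one⟩ 0)
  exact Set.indicator_le' (fun r hr => hM r hr _) (fun _ _ => hM0) _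

lemma measurable_driftNorm (x : E d) {f : ℝ → E d → E d}
    (hf : Measurable fun z : ℝ × E d => f z.1 z.2) : Measurable (driftNorm x f) := by
  have h1 : Measurable fun z : ℝ × E d => ‖f z.1 (x + z.2)‖ :=
    (hf.comp (measurable_fst.prodMk (measurable_snd.const_add x))).norm
  exact h1.indicator (measurable_fst measurableSet_Icc)

/-- Translation invariance of Lebesgue measure removes `x`, so the constants do not depend on the
starting point. -/
lemma scalarMixed_driftNorm {p q : ℝ} (x : E d) {f : ℝ → E d → E d}
    (hf : Measurable fun z : ℝ × E d => f z.1 z.2) {s t : ℝ} (hs : 0 ≤ s) (ht : t ≤ 1) :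
    scalarMixed p q (driftNorm x f) s t = mixedNorm p q s t f := by
  unfold scalarMixed mixedNorm
  congr 1
  rw [← setLIntegral_congr (μ := volume) (Ioc_ae_eq_Icc (a := s) (b := t))]
  refine setLIntegral_congr_fun measurableSet_Ioc fun r hr => ?_
  have hr' : r ∈ Set.Icc (0 : ℝ) 1 := ⟨hs.trans hr.1.le, hr.2.trans ht⟩
  have hfr : Measurable (f r) := hf.comp measurable_prodMk_left
  simp only [driftNorm_of_mem hr']
  rw [eLpNorm_norm]
  congr 1
  exact eLpNorm_comp_measurePreserving (g := f r) hfr.aestronglyMeasurable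
    (measurePreserving_add_left volume x)

lemma eVariationOn_le_accum {Ω : Type*} {v : ℝ → Ω → ℝ≥0∞} {ω : Ω} {g : ℝ → E d}
    (h : ∀ a b : ℝ, 0 ≤ a → a ≤ b → b ≤ 1 → ‖g b - g a‖ₑ ≤ accum v a b ω) {s t : ℝ} (hs : 0 ≤ s)
    (ht : t ≤ 1) : eVariationOn g (Set.Icc s t) ≤ accum v s t ω := by
  refine iSup_le fun ⟨n, u, hu, hmem⟩ => ?_
  calc ∑ i ∈ Finset.range n, edist (g (u (i + 1))) (g (u i))
      ≤ ∑ i ∈ Finset.range n, accum v (u i) (u (i + 1)) ω := by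
        refine Finset.sum_le_sum fun i _ => ?_
        rw [edist_eq_enorm_sub]
        exact h _ _ (hs.trans (hmem i).1) (hu (Nat.le_succ i)) ((hmem (i + 1)).2.trans ht)
    _ = accum v (u 0) (u n) ω := sum_setLIntegral_Ioc _ hu n
    _ ≤ accum v s t ω := accum_mono v (hmem 0).1 (hmem n).2 ω

/-- The path starts at `0`, so its supremum is controlled by level `0` of the dyadic sum; the
seminorm contributes the other `4`. -/
lemma holderNorm_le {Ω : Type*} {v : ℝ → Ω → ℝ≥0∞} {ω : Ω} {g : ℝ → E d} (hg0 : g 0 = 0)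
    (h : ∀ a b : ℝ, 0 ≤ a → a ≤ b → b ≤ 1 → ‖g b - g a‖ₑ ≤ accum v a b ω) {γ : ℝ} (hγ0 : 0 ≤ γ)
    (hγ1 : γ ≤ 1) {n : ℕ} (hn : n ≠ 0) :
    holderNorm γ g ≤ 5 * dyadicSup v γ n ω ^ (1 / (n : ℝ)) := by
  set X := dyadicSup v γ n ω ^ (1 / (n : ℝ))
  have h1 : (⨆ t ∈ Set.Icc (0 : ℝ) 1, ‖g t‖ₑ) ≤ X := by
    refine iSup₂_le fun t ht => ?_
    calc ‖g t‖ₑ = ‖g t - g 0‖ₑ := by rw [hg0, sub_zero]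
      _ ≤ accum v 0 t ω := h 0 t le_rfl ht.1 ht.2
      _ ≤ accum v 0 1 ω := accum_mono v le_rfl ht.2 ω
      _ ≤ X := by
        have := accum_dyadic_le (v := v) (γ := γ) (k := 0) (i := 0) hn (by norm_num) ω
        simpa [dyadicPt, X] using this
  have h2 : (⨆ s ∈ Set.Icc (0 : ℝ) 1, ⨆ t ∈ Set.Icc (0 : ℝ) 1, ⨆ _ : s < t,
      ‖g t - g s‖ₑ / ENNReal.ofReal ((t - s) ^ γ)) ≤ 4 * X := by
    refine iSup₂_le fun s hs => iSup₂_le fun t ht => iSup_le fun hst => ?_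
    refine le_trans ?_ (accum_div_le (v := v) hγ0 hγ1 hn hs.1 hst ht.2 ω)
    exact ENNReal.div_le_div_right (h s t hs.1 hst.le ht.2) _
  calc holderNorm γ g ≤ X + 4 * X := add_le_add h1 h2
    _ = 5 * X := by ring

variable {Ω : Type*} [mΩ : MeasurableSpace Ω] {P : Measure Ω} {ℱ : Filtration ℝ mΩ}
  {Y ψ : ℝ → Ω → E d} {x : E d} {f : ℝ → E d → E d}

/-- A solution is indistinguishable on `[0,1]` from a path with continuous trajectories that is
controlled by the norm of the drift. -/
lemma IsSolution.exists_controlledPath (hY : Measurable (Function.uncurry Y))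
    (hf : Measurable fun z : ℝ × E d => f z.1 z.2)
    (hψ : ∀ t ∈ Set.Icc (0 : ℝ) 1, Measurable[ℱ t] (ψ t)) (hsol : IsSolution P x f Y ψ) :
    ∃ φ : ℝ → Ω → E d,
      ControlledPath P ℱ φ (fun r ω => ENNReal.ofReal (driftNorm x f (r, φ r ω + Y r ω))) ∧
      ∀ᵐ ω ∂P, ψ 0 ω = 0 ∧ ∀ a b : ℝ, 0 ≤ a → a ≤ b → b ≤ 1 → ‖ψ b ω - ψ a ω‖ₑ ≤
        accum (fun r ω => ENNReal.ofReal (driftNorm x f (r, φ r ω + Y r ω))) a b ω := by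
  classical
  set good : Set Ω := {ω | IntegrableOn (fun r => f r (x + ψ r ω + Y r ω)) (Set.Icc 0 1) volume ∧
    ∀ t ∈ Set.Icc (0 : ℝ) 1, ψ t ω = ∫ r in (0 : ℝ)..t, f r (x + ψ r ω + Y r ω)} with hgood
  have hgood0 : P goodᶜ = 0 := hsol
  -- The exceptional set need not be measurable. Its measurable hull is null but need not lie in `ℱ
  -- r`, hence adaptedness of `φ` only up to null sets.
  set N := toMeasurable P goodᶜ
  have hNm : MeasurableSet N := measurableSet_toMeasurable _ _
  have hN0 : P N = 0 := by rw [measure_toMeasurable, hgood0]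
  have hNgood : ∀ ω, ω ∉ N → ω ∈ good := fun ω hω => by
    by_contra h
    exact hω (subset_toMeasurable _ _ h)
  have hNae : ∀ᵐ ω ∂P, ω ∉ N := measure_eq_zero_iff_ae_notMem.1 hN0
  -- Clamping time extends the trajectory continuously to all of `ℝ`, which gives joint
  -- measurability.
  set clamp : ℝ → ℝ := fun r => max 0 (min 1 r)
  have hclamp : ∀ r, clamp r ∈ Set.Icc (0 : ℝ) 1 := fun r =>
    ⟨le_max_left _ _, max_le zero_le_one (min_le_left _ _)⟩
  have hclamp' : ∀ r ∈ Set.Icc (0 : ℝ) 1, clamp r = r := fun r hr => by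
    simp only [clamp]; rw [min_eq_right hr.2, max_eq_right hr.1]
  set φ : ℝ → Ω → E d := fun r ω => if ω ∈ N then 0 else ψ (clamp r) ω with hφdef
  have hφψ : ∀ ω, ω ∉ N → ∀ r ∈ Set.Icc (0 : ℝ) 1, φ r ω = ψ r ω := by
    intro ω hω r hr
    simp only [hφdef, if_neg hω, hclamp' r hr]
  have hmeas : ∀ r, Measurable (φ r) := fun r =>
    Measurable.ite hNm measurable_const ((hψ _ (hclamp r)).mono (ℱ.le _) le_rfl)
  have hcont : ∀ ω, Continuous fun r => φ r ω := by
    intro ω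
    by_cases hω : ω ∈ N
    · simp only [hφdef, if_pos hω]
      exact continuous_const
    · have hg := hNgood ω hω
      have h1 : ContinuousOn (fun t => ∫ r in (0 : ℝ)..t, f r (x + ψ r ω + Y r ω))
          (Set.uIcc 0 1) :=
        intervalIntegral.continuousOn_primitive_interval (by
          rw [Set.uIcc_of_le zero_le_one]; exact hg.1)
      rw [Set.uIcc_of_le zero_le_one] at h1
      have h2 : (fun r => φ r ω) = (fun t => ∫ r in (0 : ℝ)..t, f r (x + ψ r ω + Y r ω)) ∘ clamp := by
        ext1 r
        simp only [hφdef, if_neg hω, Function.comp]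
        exact hg.2 _ (hclamp r)
      rw [h2]
      exact h1.comp_continuous (by fun_prop) hclamp
  have hctrl : ∀ ω, ω ∉ N → ∀ a b : ℝ, 0 ≤ a → a ≤ b → b ≤ 1 → ‖ψ b ω - ψ a ω‖ₑ ≤
      accum (fun r ω => ENNReal.ofReal (driftNorm x f (r, φ r ω + Y r ω))) a b ω := by
    intro ω hω a b ha hab hb
    obtain ⟨hint, hsolω⟩ := hNgood ω hω
    have hii : ∀ c ∈ Set.Icc (0 : ℝ) 1,
        IntervalIntegrable (fun r => f r (x + ψ r ω + Y r ω)) volume 0 c := by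
      intro c hc
      rw [intervalIntegrable_iff_integrableOn_Icc_of_le hc.1]
      exact hint.mono_set (Set.Icc_subset_Icc_right hc.2)
    have hb' : b ∈ Set.Icc (0 : ℝ) 1 := ⟨ha.trans hab, hb⟩
    have ha' : a ∈ Set.Icc (0 : ℝ) 1 := ⟨ha, hab.trans hb⟩
    rw [hsolω b hb', hsolω a ha', intervalIntegral.integral_interval_sub_left (hii b hb')
      (hii a ha'), intervalIntegral.integral_of_le hab]
    refine (enorm_integral_le_lintegral_enorm _).trans_eq ?_
    refine setLIntegral_congr_fun measurableSet_Ioc fun r hr => ?_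
    have hr' : r ∈ Set.Icc (0 : ℝ) 1 := ⟨ha.trans hr.1.le, hr.2.trans hb⟩
    simp only
    rw [driftNorm_of_mem hr', hφψ ω hω r hr', ofReal_norm, add_assoc]
  refine ⟨φ, ⟨hcont, hmeas, fun r hr => ?_, ?_, ?_⟩, ?_⟩
  · refine ⟨ψ r, (hψ r hr).stronglyMeasurable, ?_⟩
    filter_upwards [hNae] with ω hω using hφψ ω hω r hr
  · have hφm : Measurable (Function.uncurry φ) :=
      measurable_uncurry_of_continuous_of_measurable hcont hmeas
    have h1 : Measurable fun z : ℝ × Ω => (z.1, φ z.1 z.2 + Y z.1 z.2) :=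
      measurable_fst.prodMk (hφm.add hY)
    exact ((measurable_driftNorm x hf).comp h1).ennreal_ofReal
  · filter_upwards [hNae] with ω hω a b ha hab hb
    rw [hφψ ω hω b ⟨ha.trans hab, hb⟩, hφψ ω hω a ⟨ha, hab.trans hb⟩]
    exact hctrl ω hω a b ha hab hb
  · filter_upwards [hNae] with ω hω
    refine ⟨?_, hctrl ω hω⟩
    have := (hNgood ω hω).2 0 ⟨le_rfl, zero_le_one⟩
    simpa using this

end Solution

end SingularDrift

end

/-! ### Choice of exponents and conclusion. -/

theorem corollary3p10 {d : ℕ} (hd : 1 ≤ d) (H : ℝ) (hH0 : 0 < H) (hH1 : H < 1)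
    (p q : ℝ) (hp : 1 ≤ p) (hq : 1 ≤ q) (hmain : (1 - H) / q + H * d / p < 1 - H)
    (m : ℝ) (hm : 2 ≤ m) (κ : ℝ≥0) (K : ℝ → ℝ≥0∞ → ℝ≥0) :
    ∃ C : ℝ, 0 < C ∧ ∃ γ : ℝ, 0 < γ ∧ γ < 1 ∧
      ∀ (Ω : Type*) [mΩ : MeasurableSpace Ω] (P : Measure Ω) [IsProbabilityMeasure P]
        (ℱ : Filtration ℝ mΩ) (Y : ℝ → Ω → SingularDrift.E d),
        Measurable (fun z : ℝ × Ω => Y z.1 z.2) →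
        (∀ t ∈ Set.Icc (0 : ℝ) 1, Measurable[ℱ t] (Y t)) →
        (∀ t ∈ Set.Icc (0 : ℝ) 1, Integrable (Y t) P) →
        SingularDrift.NoiseAssumption P ℱ H κ K Y →
      ∀ (x : SingularDrift.E d) (f : ℝ → SingularDrift.E d → SingularDrift.E d),
        Measurable (fun z : ℝ × SingularDrift.E d => f z.1 z.2) →
        (∃ M : ℝ, ∀ r ∈ Set.Icc (0 : ℝ) 1, ∀ y, ‖f r y‖ ≤ M) →
        SingularDrift.mixedNorm p q 0 1 f < ∞ →
      ∀ ψ : ℝ → Ω → SingularDrift.E d,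
        (∀ t ∈ Set.Icc (0 : ℝ) 1, Measurable[ℱ t] (ψ t)) →
        SingularDrift.IsSolution P x f Y ψ →
        (∀ s t : ℝ, 0 ≤ s → s ≤ t → t ≤ 1 →
          eLpNorm (fun ω => eVariationOn (fun r => ψ r ω) (Set.Icc s t)) (ENNReal.ofReal m) P ≤
            ENNReal.ofReal C *
              (SingularDrift.mixedNorm p q s t f + SingularDrift.mixedNorm p q s t f ^ q) *
              ENNReal.ofReal ((t - s) ^ (1 - H - H * d / p - (1 - H) / q))) ∧
        (∀ r : ℝ, 0 < r →
          P {ω | ENNReal.ofReal r ≤ SingularDrift.holderNorm γ (fun t => ψ t ω)} ≤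
            ENNReal.ofReal C * (1 + SingularDrift.mixedNorm p q 0 1 f ^ q) ^ m *
              ENNReal.ofReal (r ^ (-m))) := by
  have hdR : (0 : ℝ) < d := by exact_mod_cast hd
  have hb0 : 0 < H * d / p := by positivity
  have h1H : 0 < 1 - H := by linarith
  have hq0 : 0 < q := by linarith
  set b := H * d / p with hbdef
  -- The threshold above which `(d/p + θ) * H < θ`. The main condition is equivalent to `θ₀ < 1 -
  -- 1/q`, and it rules out `q = 1`; any `θ` strictly in between works, such as the midpoint.
  set θ₀ := b / (1 - H) with hθ₀
  have hθ₀b : θ₀ * (1 - H) = b := div_mul_cancel₀ _ h1H.ne'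
  have hθ₀0 : 0 < θ₀ := by positivity
  have hiq : 0 < 1 / q := by positivity
  have hdivq : (1 - H) / q = (1 - H) * (1 / q) := by ring
  have hθ₀q : θ₀ < 1 - 1 / q := by
    rw [hθ₀, div_lt_iff₀ h1H]
    rw [hdivq] at hmain
    linarith
  have hq1 : 1 < q := by
    by_contra h
    have : q = 1 := le_antisymm (not_lt.1 h) hq
    rw [this] at hθ₀q
    linarith
  set θ := (θ₀ + (1 - 1 / q)) / 2 with hθ
  have hθlow : θ₀ < θ := by linarith
  have hθq : θ < 1 - 1 / q := by linarith
  have hθ0 : 0 < θ := by linarith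
  have hθ1 : θ < 1 := by linarith
  have hdp : d / p * H = b := by rw [hbdef]; ring
  have hα : (d / p + θ) * H < θ := by
    rw [add_mul, hdp]
    have : b < θ * (1 - H) := by rw [← hθ₀b]; gcongr
    linarith
  have hc : (d / p + θ) * H < 1 - 1 / q := hα.trans hθq
  set e := 1 - H - b - (1 - H) / q with hedef
  have he0 : 0 < e := by linarith
  have he1 : e < 1 := by
    have : 0 < (1 - H) / q := by positivity
    linarith
  -- Equality would hold at `θ = 1 - 1/q`; a smaller `θ` leaves a better power of `t - s`.
  have he : e ≤ 1 - 1 / q - (d / p + θ) * H := by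
    rw [add_mul, hdp, hedef, hdivq]
    have : θ * H ≤ (1 - 1 / q) * H := by gcongr
    linarith
  -- `n > m` allows Jensen from the `m`-th to the integer moment `n`; `n > 2 / e` makes the dyadic
  -- series converge for `γ = e / 2`.
  obtain ⟨n, hn⟩ := exists_nat_gt (max m (2 / e))
  have hnm : m < n := (le_max_left _ _).trans_lt hn
  have hne : 2 / e < n := (le_max_right _ _).trans_lt hn
  have hn0 : n ≠ 0 := by
    rintro rfl
    norm_num at hnm
    linarith
  have hnR : (0 : ℝ) < n := by linarith
  have hm0 : 0 < m := by linarith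
  set D := SingularDrift.momentConst d K H p q θ with hD
  have hDfin : D ≠ ∞ := SingularDrift.momentConst_ne_top hα hθ1
  set S : ℝ≥0∞ := (1 - ENNReal.ofReal (2 ^ (1 + n * (e / 2 - e))))⁻¹ with hS
  have hSfin : S ≠ ∞ := by
    rw [hS, Ne, ENNReal.inv_eq_top, tsub_eq_zero_iff_le, not_le, ENNReal.ofReal_lt_one]
    refine Real.rpow_lt_one_of_one_lt_of_neg (by norm_num) ?_
    rw [div_lt_iff₀ he0] at hne
    linarith
  set N : ℝ≥0∞ := (n.factorial : ℝ≥0∞) with hNdef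
  have hNfin : N ≠ ∞ := ENNReal.natCast_ne_top _
  set C₁ : ℝ≥0∞ := N ^ (1 / (n : ℝ)) * D with hC₁
  -- `5` is from the Hölder norm, `N * S` from the dyadic sum of `n`-th moments, and `2` from `G + G
  -- ^ q ≤ 2 * (1 + G ^ q)`.
  set C₂ : ℝ≥0∞ := (5 * (N * S) ^ (1 / (n : ℝ)) * (2 * D)) ^ m with hC₂
  have hC₁fin : C₁ ≠ ∞ :=
    ENNReal.mul_ne_top (ENNReal.rpow_ne_top_of_nonneg (by positivity) hNfin) hDfin
  have hC₂fin : C₂ ≠ ∞ := by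
    refine ENNReal.rpow_ne_top_of_nonneg hm0.le (ENNReal.mul_ne_top (ENNReal.mul_ne_top
      ENNReal.ofNat_ne_top (ENNReal.rpow_ne_top_of_nonneg (by positivity)
        (ENNReal.mul_ne_top hNfin hSfin))) (ENNReal.mul_ne_top ENNReal.ofNat_ne_top hDfin))
  set C : ℝ := (C₁ + C₂).toReal + 1 with hC
  have hCle : C₁ + C₂ ≤ ENNReal.ofReal C := by
    rw [← ENNReal.ofReal_toReal (ENNReal.add_ne_top.2 ⟨hC₁fin, hC₂fin⟩)]
    exact ENNReal.ofReal_le_ofReal (by rw [hC]; linarith)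
  refine ⟨C, by positivity, e / 2, by linarith, by linarith, ?_⟩
  intro Ω mΩ P _ ℱ Y hY hYa _ hN x f hf ⟨M, hM⟩ _ ψ hψ hsol
  obtain ⟨φ, hφ, hψφ⟩ := hsol.exists_controlledPath hY hf hψ
  set v : ℝ → Ω → ℝ≥0∞ := fun r ω =>
    ENNReal.ofReal (SingularDrift.driftNorm x f (r, φ r ω + Y r ω)) with hv
  have hmom : ∀ s t : ℝ, 0 ≤ s → s ≤ t → t ≤ 1 → ∫⁻ ω, SingularDrift.accum v s t ω ^ n ∂P ≤
      N * (D * (SingularDrift.mixedNorm p q s t f + SingularDrift.mixedNorm p q s t f ^ q) *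
        ENNReal.ofReal ((t - s) ^ e)) ^ n := by
    intro s t hs hst ht
    rw [← SingularDrift.scalarMixed_driftNorm x hf hs ht]
    exact SingularDrift.lintegral_accum_pow_le hN hd hp hq1 hH0.le hθ0.le hθ1 (by linarith) hc hα
      he0.le he hY hYa (SingularDrift.measurable_driftNorm x hf)
      (SingularDrift.driftNorm_nonneg x f) (SingularDrift.driftNorm_le hM) hφ hs hst ht n
  have hnn : ∀ X : ℝ≥0∞, (X ^ n) ^ (1 / (n : ℝ)) = X := by
    intro X
    rw [← ENNReal.rpow_natCast, ← ENNReal.rpow_mul, mul_one_div_cancel hnR.ne', ENNReal.rpow_one]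
  refine ⟨fun s t hs hst ht => ?_, fun r hr => ?_⟩
  · have hacc := SingularDrift.measurable_accum hφ.measv s t
    calc eLpNorm (fun ω => eVariationOn (fun r => ψ r ω) (Set.Icc s t)) (ENNReal.ofReal m) P
        ≤ eLpNorm (SingularDrift.accum v s t) (ENNReal.ofReal m) P := by
          refine eLpNorm_mono_enorm_ae ?_
          filter_upwards [hψφ] with ω hω
          exact SingularDrift.eVariationOn_le_accum hω.2 hs ht
      _ ≤ eLpNorm (SingularDrift.accum v s t) (n : ℝ≥0∞) P := by
          refine eLpNorm_le_eLpNorm_of_exponent_le ?_ hacc.aestronglyMeasurable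
          exact ENNReal.ofReal_le_of_le_toReal (by simpa using hnm.le)
      _ = (∫⁻ ω, SingularDrift.accum v s t ω ^ n ∂P) ^ (1 / (n : ℝ)) := by
          rw [eLpNorm_eq_lintegral_rpow_enorm_toReal (by exact_mod_cast hn0)
            (ENNReal.natCast_ne_top n)]
          simp
      _ ≤ (N * (D * (SingularDrift.mixedNorm p q s t f +
            SingularDrift.mixedNorm p q s t f ^ q) * ENNReal.ofReal ((t - s) ^ e)) ^ n) ^
              (1 / (n : ℝ)) := ENNReal.rpow_le_rpow (hmom s t hs hst ht) (by positivity)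
      _ = C₁ * (SingularDrift.mixedNorm p q s t f + SingularDrift.mixedNorm p q s t f ^ q) *
            ENNReal.ofReal ((t - s) ^ e) := by
          rw [ENNReal.mul_rpow_of_nonneg _ _ (by positivity), hnn, hC₁]
          ring
      _ ≤ _ := by
          gcongr
          exact le_self_add.trans hCle
  · set G := SingularDrift.mixedNorm p q 0 1 f with hG
    set X := SingularDrift.dyadicSup v (e / 2) n with hX
    have hXm : Measurable X := SingularDrift.measurable_dyadicSup hφ.measv _ _
    have hXint : ∫⁻ ω, X ω ∂P ≤ N * (D * (G + G ^ q)) ^ n * S := by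
      refine SingularDrift.lintegral_dyadicSup_le hφ.measv fun s t hs hst ht => ?_
      refine (hmom s t hs hst ht).trans ?_
      rw [mul_pow, ← mul_assoc]
      have hmono : SingularDrift.mixedNorm p q s t f ≤ G := by
        rw [hG, ← SingularDrift.scalarMixed_driftNorm x hf hs ht,
          ← SingularDrift.scalarMixed_driftNorm x hf le_rfl le_rfl]
        exact SingularDrift.scalarMixed_mono hq0.le _ hs ht
      gcongr
    have hGle : G + G ^ q ≤ 2 * (1 + G ^ q) := by
      have : G ≤ 1 + G ^ q := by
        rcases le_total G 1 with h | h
        · exact le_add_right h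
        · refine le_add_left ?_
          simpa using ENNReal.rpow_le_rpow_of_exponent_le h hq
      calc G + G ^ q ≤ (1 + G ^ q) + (1 + G ^ q) := add_le_add this le_add_self
        _ = _ := (two_mul _).symm
    have hXr : ∫⁻ ω, (5 * X ω ^ (1 / (n : ℝ))) ^ m ∂P ≤ C₂ * (1 + G ^ q) ^ m := by
      have hmn : m / n ≤ 1 := by rw [div_le_one hnR]; exact hnm.le
      calc ∫⁻ ω, (5 * X ω ^ (1 / (n : ℝ))) ^ m ∂P
          = 5 ^ m * ∫⁻ ω, X ω ^ (m / n) ∂P := by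
            rw [← lintegral_const_mul _ (hXm.pow_const _)]
            refine lintegral_congr fun ω => ?_
            rw [ENNReal.mul_rpow_of_nonneg _ _ hm0.le, ← ENNReal.rpow_mul]
            congr 2; ring
        _ ≤ 5 ^ m * (∫⁻ ω, X ω ∂P) ^ (m / n) := by
            gcongr
            have := SingularDrift.lintegral_rpow_le_of_le_one P hXm.aemeasurable
              (θ := m / n) (by positivity) hmn
            simpa using this
        _ ≤ 5 ^ m * (N * (D * (2 * (1 + G ^ q))) ^ n * S) ^ (m / n) := by
            gcongr
            refine hXint.trans ?_
            gcongr
        _ = C₂ * (1 + G ^ q) ^ m := by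
            have h1 : ∀ Z : ℝ≥0∞, Z ^ (m / n) = (Z ^ (1 / (n : ℝ))) ^ m := by
              intro Z
              rw [← ENNReal.rpow_mul]; congr 1; ring
            rw [h1, hC₂, ← ENNReal.mul_rpow_of_nonneg _ _ hm0.le, mul_right_comm N,
              ENNReal.mul_rpow_of_nonneg (N * S) _ (by positivity), hnn,
              ← ENNReal.mul_rpow_of_nonneg _ _ hm0.le]
            congr 1; ring
    -- The event is compared with one for the measurable variable `X`, so that Markov's inequality
    -- needs no measurability of the Hölder norm.
    have hsub : P {ω | ENNReal.ofReal r ≤ SingularDrift.holderNorm (e / 2) (fun t => ψ t ω)} ≤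
        P {ω | ENNReal.ofReal (r ^ m) ≤ (5 * X ω ^ (1 / (n : ℝ))) ^ m} := by
      refine measure_mono_ae ?_
      filter_upwards [hψφ] with ω hω hle
      change ENNReal.ofReal (r ^ m) ≤ (5 * X ω ^ (1 / (n : ℝ))) ^ m
      rw [← ENNReal.ofReal_rpow_of_nonneg hr.le hm0.le]
      refine ENNReal.rpow_le_rpow ((show ENNReal.ofReal r ≤ _ from hle).trans ?_) hm0.le
      exact SingularDrift.holderNorm_le hω.1 hω.2 (by linarith) (by linarith) hn0
    have hmk := mul_meas_ge_le_lintegral₀ (μ := P) (f := fun ω => (5 * X ω ^ (1 / (n : ℝ))) ^ m)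
      (((hXm.pow_const _).const_mul _).pow_const _).aemeasurable (ENNReal.ofReal (r ^ m))
    have hrm : 0 < r ^ m := by positivity
    have hinv : ENNReal.ofReal (r ^ (-m)) * ENNReal.ofReal (r ^ m) = 1 := by
      rw [← ENNReal.ofReal_mul (by positivity), ← Real.rpow_add hr]; simp
    refine hsub.trans ?_
    set Q := P {ω | ENNReal.ofReal (r ^ m) ≤ (5 * X ω ^ (1 / (n : ℝ))) ^ m}
    calc Q = ENNReal.ofReal (r ^ (-m)) * (ENNReal.ofReal (r ^ m) * Q) := by
          rw [← mul_assoc, hinv, one_mul]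
      _ ≤ ENNReal.ofReal (r ^ (-m)) * (C₂ * (1 + G ^ q) ^ m) :=
          mul_le_mul_right (hmk.trans hXr) _
      _ = C₂ * (1 + G ^ q) ^ m * ENNReal.ofReal (r ^ (-m)) := by ring
      _ ≤ _ := by
          gcongr
          exact le_add_self.trans hCle
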